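/- **Theorem 4.1 (index-finding lower bounds).** Distributions are over $[n]=\{1,\dots,n\}$, $d_{\mathrm{TV}}(P,Q)=\frac12\sum_{x}|P(x)-Q(x)|$, and $U$ is the uniform distribution on $[n]$. Let $D_1,\dots,D_k$ be distributions such that, for an unknown set $\mathcal I\subseteq[k]$ of size $r$, $D_i=P$ for $i\in\mathcal I$ and $D_i=Q$ for $i\notin\mathcal I$, where $d_{\mathrm{TV}}(P,Q)\ge\varepsilon$. A (randomized) algorithm repeatedly chooses an index $i\in[k]$, adaptively as a function of its internal randomness and all previous samples, and receives a fresh independent sample from $D_i$; eventually it stops and outputs an index. It may know $n,k,r$ and $\varepsilon$. For every $\delta>0$ there is a constant $c>0$, depending only on $\delta$, such that for all integers $n\ge2$, $k\ge60$, $1\le r\le k/60$, all $0<\varepsilon\le1-\delta$, and every integer $T\ge 0$ the following hold for every such algorithm that always draws at most $T$ samples in total. (a) (One known) If $\varepsilon\le 1-\frac1n$ and, for $Q=U$, for every $\mathcal I$ of size $r$ and every $P$ with $d_{\mathrm{TV}}(P,U)\ge\varepsilon$, the algorithm outputs an element of $\mathcal I$ with probability at least $0.9$, then $$T\ \ge\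 c\,\frac{k\sqrt n}{r\varepsilon^2}.$$ (b) (Both unknown) If, for every $\mathcal I$ of size $r$ and all $P,Q$ with $d_{\mathrm{TV}}(P,Q)\ge\varepsilon$, the algorithm outputs an element of $\mathcal I$ with probability at least $0.9$, then $$T\ \ge\ c\,\max\left\{\frac{k\sqrt n}{r\varepsilon^2},\ \left(\frac{nk}{r\varepsilon^2}\right)^{2/3}\right\}.$$ In particular, with $\delta=\frac12$, the lower bounds hold with a universal constant for all $\varepsilon\le\frac12$ and all $n\ge2$. -/

import Mathlib

/-- Total variation distance `½ ∑ₓ |P(x) - Q(x)|` of two distributions on `[n]`. -/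
noncomputable def tvDist {n : ℕ} (P Q : PMF (Fin n)) : ℝ :=
  (1 / 2) * ∑ x : Fin n, |(P x).toReal - (Q x).toReal|

/-- A deterministic adaptive algorithm with sample access to `k` distributions on `[n]` whose
output is an index in `[k]`.  It either stops and outputs `i`, or draws a fresh sample from the
`i`-th distribution and continues in a way that may depend on everything seen so far. -/
inductive SampleTree (k n : ℕ) : Type
  | output (i : Fin k) : SampleTree k n
  | query (i : Fin k) (next : Fin n → SampleTree k n) : SampleTree k n

/-- The largest number of samples that a deterministic adaptive algorithm can draw. -/
def SampleTree.depth {k n : ℕ} : SampleTree k n → ℕ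
  | .output _ => 0
  | .query _ next => 1 + Finset.univ.sup (fun x => (next x).depth)

/-- The law of the output when the `k` sampled distributions are `D 0, …, D (k - 1)`;
every query to `i` returns a fresh independent sample from `D i`. -/
noncomputable def SampleTree.run {k n : ℕ} (D : Fin k → PMF (Fin n)) :
    SampleTree k n → PMF (Fin k)
  | .output i => PMF.pure i
  | .query i next => (D i).bind (fun x => (next x).run D)

/-- A randomized adaptive algorithm: the internal randomness selects a deterministic adaptive
algorithm.  (There are only countably many of these, so a `PMF` is the most general law.) -/
abbrev RandomizedAlgorithm (k n : ℕ) : Type := PMF (SampleTree k n)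

/-- The algorithm never draws more than `T` samples in total. -/
def RandomizedAlgorithm.UsesAtMost {k n : ℕ} (A : RandomizedAlgorithm k n) (T : ℕ) : Prop :=
  ∀ t ∈ A.support, t.depth ≤ T

/-- The law of the output over the internal randomness and the samples. -/
noncomputable def RandomizedAlgorithm.run {k n : ℕ} (A : RandomizedAlgorithm k n)
    (D : Fin k → PMF (Fin n)) : PMF (Fin k) :=
  PMF.bind A (fun t => t.run D)

/-- The instance with `D i = P` for `i ∈ I` and `D i = Q` for `i ∉ I`. -/
noncomputable def clusterInstance {k n : ℕ} (I : Finset (Fin k)) (P Q : PMF (Fin n)) :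
    Fin k → PMF (Fin n) :=
  fun i => if i ∈ I then P else Q

/-- On the instance `(I, P, Q)` the algorithm returns an index in `I` with probability
at least `0.9`. -/
def RandomizedAlgorithm.FindsIndex {k n : ℕ} (A : RandomizedAlgorithm k n)
    (I : Finset (Fin k)) (P Q : PMF (Fin n)) : Prop :=
  (9 / 10 : ℝ) ≤ ∑ i ∈ I, (A.run (clusterInstance I P Q) i).toReal

/-- Index finding when the larger cluster is known to have the uniform distribution: success on
every instance whose cluster `I` has size `r` and law `P` at distance at least `ε` from uniform. -/
def RandomizedAlgorithm.SolvesOneKnown {k n : ℕ} [NeZero n] (A : RandomizedAlgorithm k n)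
    (r : ℕ) (ε : ℝ) : Prop :=
  ∀ (I : Finset (Fin k)) (P : PMF (Fin n)), I.card = r →
    ε ≤ tvDist P (PMF.uniformOfFintype (Fin n)) →
    A.FindsIndex I P (PMF.uniformOfFintype (Fin n))

/-- Index finding when both distributions are unknown: success on every instance whose cluster
`I` has size `r` and whose two laws are at distance at least `ε`. -/
def RandomizedAlgorithm.SolvesBothUnknown {k n : ℕ} (A : RandomizedAlgorithm k n)
    (r : ℕ) (ε : ℝ) : Prop :=
  ∀ (I : Finset (Fin k)) (P Q : PMF (Fin n)), I.card = r →
    ε ≤ tvDist P Q → A.FindsIndex I P Q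

/-! An algorithm that finds the cluster must sample it often enough to tell `P` from `Q`. Take `q =
⌊k/r⌋` disjoint candidate clusters and compare each instance with the null instance in which every
law is `Q`. Under the null, the probabilities of outputting an index of the various candidates sum
to at most `1`, and the expected numbers of queries to them to at most `T`. A typical candidate is
therefore output rarely and queried about `T/q` times, and by Markov it rarely receives more than `m
≈ 20T/q` queries. As success `0.9` is required for every candidate, some test on `m` samples of the
candidate's law and `T` samples of `Q` must separate `P` from `Q` (`SampleTree.exists_tape_test`,
`RandomizedAlgorithm.false_of_tape_indistinguishable`). It remains to build priors on `(P, Q)` for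
which no such test exists.

One known: `P` is the uniform law with a fraction `a ≈ ε` of the mass of each block moved to a
random point of that block. Ingster's second moment method (`mixture_test_le`) bounds the χ²
distance by an exponential moment of the centred number of blocks in which two independent choices
of points agree. It stays small while `m` is at most a small multiple of `√n/ε²`
(`sum_second_moment_block_le`).

Both unknown: `Q` is random too. A random set of `K ≈ T` heavy blocks carries all but a mass of
order `ε`, and `Q` is flat inside every block. `P` agrees with `Q` on heavy blocks and concentrates
each light block on one random point. Block labels have the same law under `P` and `Q`, so only the
positions inside a light block hit repeatedly carry information. Such repetitions are masked by the
heavy blocks: the samples miss at least half of these, and exchanging a light block with an unseen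
heavy one shows that a block seen `c` times has posterior weight at most `(lam/η)^c · 2N/K` of being
light (`sum_heavyWeight_insert_le`). Applied to two posterior draws, this bounds the conditional
second moment by `(1+ρ)` to the number of repetitions (`sum_heavyWeight_blocks_le`), which has a
small exponential moment unless `T³` is of order `(nk/(rε²))²`. -/

open Finset

/-! ### Success probability and query counts of a decision tree -/

/-- The probability that the output lies in `I`. -/
noncomputable def SampleTree.success {k n : ℕ} (D : Fin k → PMF (Fin n)) (I : Finset (Fin k))
    (t : SampleTree k n) : ℝ :=
  ∑ i ∈ I, (t.run D i).toReal

/-- The expected number of samples drawn from the distributions with index in `I`. -/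
noncomputable def SampleTree.expQueries {k n : ℕ} (D : Fin k → PMF (Fin n)) (I : Finset (Fin k)) :
    SampleTree k n → ℝ
  | .output _ => 0
  | .query i next => (if i ∈ I then 1 else 0) + ∑ x, (D i x).toReal * (next x).expQueries D I

theorem PMF.sum_toReal_eq_one {α : Type*} [Fintype α] (p : PMF α) : ∑ x, (p x).toReal = 1 := by
  rw [← ENNReal.toReal_sum (fun x _ => p.apply_ne_top x), ← tsum_fintype (L := .unconditional _),
    p.tsum_coe, ENNReal.toReal_one]

theorem SampleTree.success_output {k n : ℕ} (D : Fin k → PMF (Fin n)) (I : Finset (Fin k))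
    (i : Fin k) : (SampleTree.output i : SampleTree k n).success D I = if i ∈ I then 1 else 0 := by
  have h : ∀ x : Fin k, ((PMF.pure i) x).toReal = if x = i then 1 else 0 := by
    intro x
    rw [PMF.pure_apply]
    split_ifs <;> simp
  simp only [SampleTree.success, SampleTree.run, h, Finset.sum_ite_eq']

theorem SampleTree.success_query {k n : ℕ} (D : Fin k → PMF (Fin n)) (I : Finset (Fin k))
    (i : Fin k) (next : Fin n → SampleTree k n) :
    (SampleTree.query i next).success D I =
      ∑ x, (D i x).toReal * (next x).success D I := by
  simp only [SampleTree.success, SampleTree.run, Finset.mul_sum]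
  rw [Finset.sum_comm]
  refine Finset.sum_congr rfl fun j _ => ?_
  rw [PMF.bind_apply, tsum_fintype, ENNReal.toReal_sum]
  · simp only [ENNReal.toReal_mul]
  · exact fun x _ => ENNReal.mul_ne_top (PMF.apply_ne_top _ _) (PMF.apply_ne_top _ _)

theorem PMF.weighted_sum_le {α : Type*} [Fintype α] (p : PMF α) {f : α → ℝ} {c : ℝ}
    (h : ∀ x, f x ≤ c) : ∑ x, (p x).toReal * f x ≤ c := by
  calc ∑ x, (p x).toReal * f x ≤ ∑ x, (p x).toReal * c :=
        Finset.sum_le_sum fun x _ => mul_le_mul_of_nonneg_left (h x) ENNReal.toReal_nonneg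
    _ = c := by rw [← Finset.sum_mul, p.sum_toReal_eq_one, one_mul]

/-- The hypothesis `hI` expresses disjointness of the sets, so the events that the output lies in
them exclude one another. -/
theorem SampleTree.sum_success_le_one {k n q : ℕ} (D : Fin k → PMF (Fin n))
    (I : Fin q → Finset (Fin k)) (hI : ∀ i, ∑ j, (if i ∈ I j then (1 : ℝ) else 0) ≤ 1)
    (t : SampleTree k n) : ∑ j, t.success D (I j) ≤ 1 := by
  induction t with
  | output i => simpa only [SampleTree.success_output] using hI i
  | query i next ih =>
    simp only [SampleTree.success_query]
    rw [Finset.sum_comm]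
    simp only [← Finset.mul_sum]
    exact PMF.weighted_sum_le _ ih

theorem SampleTree.sum_expQueries_le_depth {k n q : ℕ} (D : Fin k → PMF (Fin n))
    (I : Fin q → Finset (Fin k)) (hI : ∀ i, ∑ j, (if i ∈ I j then (1 : ℝ) else 0) ≤ 1)
    (t : SampleTree k n) : ∑ j, t.expQueries D (I j) ≤ t.depth := by
  induction t with
  | output i => simp [SampleTree.expQueries, SampleTree.depth]
  | query i next ih =>
    simp only [SampleTree.expQueries, SampleTree.depth, Finset.sum_add_distrib]
    rw [Finset.sum_comm]
    simp only [← Finset.mul_sum]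
    push_cast
    refine add_le_add (hI i) (PMF.weighted_sum_le _ fun x => (ih x).trans ?_)
    exact_mod_cast Finset.le_sup (f := fun x => (next x).depth) (Finset.mem_univ x)

/-! ### Sample tapes and the reduction to a testing problem -/

/-- Expectation over a tape of `m` independent samples with law `p`. -/
def tapeSum {α : Type*} [Fintype α] (p : α → ℝ) (m : ℕ) (F : (Fin m → α) → ℝ) : ℝ :=
  ∑ xs : Fin m → α, (∏ s, p (xs s)) * F xs

theorem tapeSum_succ {α : Type*} [Fintype α] (p : α → ℝ) (m : ℕ) (F : (Fin (m + 1) → α) → ℝ) :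
    tapeSum p (m + 1) F =
      ∑ x, p x * tapeSum p m (fun xs => F (Fin.cons x xs)) := by
  unfold tapeSum
  rw [← (Fin.consEquiv (fun _ : Fin (m + 1) => α)).sum_comp, Fintype.sum_prod_type]
  refine Finset.sum_congr rfl fun x _ => ?_
  rw [Finset.mul_sum]
  refine Finset.sum_congr rfl fun xs _ => ?_
  simp [Fin.consEquiv, Fin.prod_univ_succ, mul_assoc]

theorem tapeSum_zero {α : Type*} [Fintype α] (p : α → ℝ) (F : (Fin 0 → α) → ℝ) :
    tapeSum p 0 F = F Fin.elim0 := by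
  unfold tapeSum
  simp [Subsingleton.elim (default : Fin 0 → α) Fin.elim0]

theorem tapeSum_one {α : Type*} [Fintype α] (p : α → ℝ) (hp : ∑ x, p x = 1) (m : ℕ) (c : ℝ) :
    tapeSum p m (fun _ => c) = c := by
  induction m with
  | zero => rw [tapeSum_zero]
  | succ m ih => rw [tapeSum_succ]; simp only [ih, ← Finset.sum_mul, hp, one_mul]

theorem tapeSum_mul {α : Type*} [Fintype α] (p : α → ℝ) (m : ℕ) (c : ℝ) (F : (Fin m → α) → ℝ) :
    c * tapeSum p m F = tapeSum p m (fun xs => c * F xs) := by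
  unfold tapeSum
  rw [Finset.mul_sum]
  exact Finset.sum_congr rfl fun _ _ => by ring

theorem tapeSum_sum {α β : Type*} [Fintype α] (p : α → ℝ) (m : ℕ) (s : Finset β)
    (F : β → (Fin m → α) → ℝ) :
    ∑ y ∈ s, tapeSum p m (F y) = tapeSum p m (fun xs => ∑ y ∈ s, F y xs) := by
  unfold tapeSum
  rw [Finset.sum_comm]
  exact Finset.sum_congr rfl fun _ _ => by rw [Finset.mul_sum]

/-- A tree can be run on two prerecorded tapes, one for the indices in `I` and one for the others;
it is stopped, and declared successful, when the first tape is exhausted. -/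
theorem SampleTree.exists_tape_test {k n : ℕ} (I : Finset (Fin k)) (m₀ : ℕ) (t : SampleTree k n) :
    ∀ m T : ℕ, m ≤ m₀ → t.depth ≤ T →
      ∃ G : (Fin m → Fin n) → (Fin T → Fin n) → ℝ,
        (∀ xs ys, 0 ≤ G xs ys ∧ G xs ys ≤ 1) ∧
        (∀ P Q : PMF (Fin n), t.success (clusterInstance I P Q) I ≤
          tapeSum (fun x => (P x).toReal) m fun xs =>
            tapeSum (fun x => (Q x).toReal) T fun ys => G xs ys) ∧
        (∀ Q : PMF (Fin n), (tapeSum (fun x => (Q x).toReal) m fun xs =>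
            tapeSum (fun x => (Q x).toReal) T fun ys => G xs ys) ≤
          t.success (fun _ => Q) I + (t.expQueries (fun _ => Q) I + (m₀ - m)) / (m₀ + 1)) := by
  induction t with
  | output i =>
    intro m T hm hT
    refine ⟨fun _ _ => if i ∈ I then 1 else 0, fun _ _ => by split_ifs <;> simp,
      fun P Q => ?_, fun Q => ?_⟩
    · rw [SampleTree.success_output]
      simp only [tapeSum_one _ (PMF.sum_toReal_eq_one _), le_refl]
    · rw [SampleTree.success_output]
      simp only [tapeSum_one _ (PMF.sum_toReal_eq_one _), SampleTree.expQueries]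
      have h1 : (m : ℝ) ≤ m₀ := by exact_mod_cast hm
      have h2 : (0 : ℝ) ≤ (0 + ((m₀ : ℝ) - m)) / (m₀ + 1) := by
        apply div_nonneg <;> linarith [(Nat.cast_nonneg m₀ : (0 : ℝ) ≤ m₀)]
      linarith
  | query i next ih =>
    intro m T hm hT
    have hdep : ∀ x, (next x).depth + 1 ≤ T := by
      intro x
      have := Finset.le_sup (f := fun x => (next x).depth) (Finset.mem_univ x)
      simp only [SampleTree.depth] at hT
      omega
    have hm₀ : (0 : ℝ) < (m₀ : ℝ) + 1 := by positivity
    by_cases hi : i ∈ I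
    · rcases m with _ | m
      -- Tape exhausted: the constant test `1` is admissible under the null because the pending
      -- query already makes `expQueries + m₀ ≥ m₀ + 1`. This is Markov's inequality in inductive
      -- form.
      · refine ⟨fun _ _ => 1, fun _ _ => by simp, fun P Q => ?_, fun Q => ?_⟩
        · simp only [tapeSum_one _ (PMF.sum_toReal_eq_one _)]
          rw [← PMF.sum_toReal_eq_one ((SampleTree.query i next).run (clusterInstance I P Q))]
          exact Finset.sum_le_univ_sum_of_nonneg fun _ => ENNReal.toReal_nonneg
        · simp only [tapeSum_one _ (PMF.sum_toReal_eq_one _), SampleTree.expQueries, hi, if_true]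
          have hs : 0 ≤ (SampleTree.query i next).success (fun _ => Q) I :=
            Finset.sum_nonneg fun _ _ => ENNReal.toReal_nonneg
          have hE : ∀ t : SampleTree k n, 0 ≤ t.expQueries (fun _ => Q) I := by
            intro t
            induction t with
            | output i => simp [SampleTree.expQueries]
            | query i next ih =>
              simp only [SampleTree.expQueries]
              refine add_nonneg (by split_ifs <;> simp) (Finset.sum_nonneg fun x _ => ?_)
              exact mul_nonneg ENNReal.toReal_nonneg (ih x)
          have hE' : 0 ≤ ∑ x, (Q x).toReal * (next x).expQueries (fun _ => Q) I :=
            Finset.sum_nonneg fun x _ => mul_nonneg ENNReal.toReal_nonneg (hE _)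
          have : 1 ≤ ((1 + ∑ x, (Q x).toReal * (next x).expQueries (fun _ => Q) I) +
              ((m₀ : ℝ) - (0 : ℕ))) / (m₀ + 1) := by
            rw [le_div_iff₀ hm₀]
            push_cast
            linarith
          linarith
      -- Reading one cell lowers the expected number of remaining queries by one and raises `m₀ - m`
      -- by one, so the Markov term is preserved.
      · choose G hG1 hG2 hG3 using fun x => ih x m T (by omega) (by have := hdep x; omega)
        refine ⟨fun xs ys => G (xs 0) (Fin.tail xs) ys, fun xs ys => hG1 _ _ _, fun P Q => ?_,
          fun Q => ?_⟩
        · rw [SampleTree.success_query, tapeSum_succ]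
          simp only [Fin.cons_zero, Fin.tail_cons, clusterInstance, hi, if_true]
          exact Finset.sum_le_sum fun x _ =>
            mul_le_mul_of_nonneg_left (hG2 x P Q) ENNReal.toReal_nonneg
        · rw [SampleTree.success_query, tapeSum_succ]
          simp only [Fin.cons_zero, Fin.tail_cons]
          refine (Finset.sum_le_sum fun x _ =>
            mul_le_mul_of_nonneg_left (hG3 x Q) ENNReal.toReal_nonneg).trans (le_of_eq ?_)
          simp only [SampleTree.expQueries, hi, if_true, mul_add, Finset.sum_add_distrib,
            mul_div_assoc', add_div, ← Finset.sum_div, ← Finset.sum_mul, PMF.sum_toReal_eq_one]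
          push_cast
          ring
    · rcases T with _ | T
      · exfalso
        simp only [SampleTree.depth] at hT
        omega
      · choose G hG1 hG2 hG3 using fun x => ih x m T hm (by have := hdep x; omega)
        have hswap : ∀ (p p' : Fin n → ℝ), (tapeSum p m fun xs => tapeSum p' (T + 1) fun ys =>
            G (ys 0) xs (Fin.tail ys)) =
            ∑ x, p' x * tapeSum p m fun xs => tapeSum p' T fun ys => G x xs ys := by
          intro p p'
          simp only [tapeSum_succ, Fin.cons_zero, Fin.tail_cons, tapeSum_mul, tapeSum_sum]
        refine ⟨fun xs ys => G (ys 0) xs (Fin.tail ys), fun xs ys => hG1 _ _ _, fun P Q => ?_,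
          fun Q => ?_⟩
        · rw [SampleTree.success_query, hswap]
          simp only [clusterInstance, hi, if_false]
          exact Finset.sum_le_sum fun x _ =>
            mul_le_mul_of_nonneg_left (hG2 x P Q) ENNReal.toReal_nonneg
        · rw [SampleTree.success_query, hswap]
          refine (Finset.sum_le_sum fun x _ =>
            mul_le_mul_of_nonneg_left (hG3 x Q) ENNReal.toReal_nonneg).trans (le_of_eq ?_)
          simp only [SampleTree.expQueries, hi, if_false, mul_add, Finset.sum_add_distrib,
            mul_div_assoc', add_div, ← Finset.sum_div, ← Finset.sum_mul, PMF.sum_toReal_eq_one]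
          ring

/-- Averaging over finitely many instances reduces randomized algorithms to deterministic ones. -/
theorem RandomizedAlgorithm.exists_tree {k n : ℕ} (A : RandomizedAlgorithm k n) {ι : Type*}
    [Fintype ι] (I : ι → Finset (Fin k)) (P Q : ι → PMF (Fin n))
    (h : ∀ a, A.FindsIndex (I a) (P a) (Q a)) :
    ∃ t ∈ A.support, (9 / 10 : ℝ) * Fintype.card ι ≤
      ∑ a, t.success (clusterInstance (I a) (P a) (Q a)) (I a) := by
  set F : SampleTree k n → ENNReal := fun t =>
    ∑ a, ∑ i ∈ I a, t.run (clusterInstance (I a) (P a) (Q a)) i with hF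
  have hFreal : ∀ t, (F t).toReal = ∑ a, t.success (clusterInstance (I a) (P a) (Q a)) (I a) := by
    intro t
    rw [hF, ENNReal.toReal_sum]
    · refine Finset.sum_congr rfl fun a _ => ?_
      rw [ENNReal.toReal_sum fun i _ => PMF.apply_ne_top _ _]
      rfl
    · exact fun a _ => ENNReal.sum_ne_top.2 fun i _ => PMF.apply_ne_top _ _
  have hFtop : ∀ t, F t ≠ ⊤ := fun t =>
    ENNReal.sum_ne_top.2 fun a _ => ENNReal.sum_ne_top.2 fun i _ => PMF.apply_ne_top _ _
  set K : ENNReal := ENNReal.ofReal ((9 / 10 : ℝ) * Fintype.card ι) with hK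
  have htot : K ≤ ∑' t, A t * F t := by
    have h1 : ∑' t, A t * F t =
        ∑ a, ∑ i ∈ I a, A.run (clusterInstance (I a) (P a) (Q a)) i := by
      simp only [hF, Finset.mul_sum]
      rw [Summable.tsum_finsetSum fun _ _ => ENNReal.summable]
      refine Finset.sum_congr rfl fun a _ => ?_
      rw [Summable.tsum_finsetSum fun _ _ => ENNReal.summable]
      rfl
    rw [h1, hK]
    apply ENNReal.ofReal_le_of_le_toReal
    rw [ENNReal.toReal_sum
      (fun a _ => ENNReal.sum_ne_top.2 fun i _ => PMF.apply_ne_top _ _)]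
    calc (9 / 10 : ℝ) * Fintype.card ι = ∑ _a : ι, (9 / 10 : ℝ) := by simp [mul_comm]
      _ ≤ _ := Finset.sum_le_sum fun a _ => by
        rw [ENNReal.toReal_sum fun i _ => PMF.apply_ne_top _ _]
        exact h a
  by_contra! hcon
  have hlt : ∀ t ∈ A.support, F t < K := by
    intro t ht
    rw [hK, ENNReal.lt_ofReal_iff_toReal_lt (hFtop t), hFreal]
    exact hcon t ht
  obtain ⟨t₀, ht₀⟩ := A.support_nonempty
  have hle : ∀ t, A t * F t ≤ A t * K := by
    intro t
    by_cases ht : t ∈ A.support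
    · gcongr
      exact (hlt t ht).le
    · rw [(A.apply_eq_zero_iff t).2 ht]; simp
  have hsum : ∑' t, A t * K = K := by rw [ENNReal.tsum_mul_right, A.tsum_coe, one_mul]
  have hfin : ∑' t, A t * F t ≠ ⊤ :=
    ne_top_of_le_ne_top (by rw [hsum]; exact ENNReal.ofReal_ne_top) (ENNReal.tsum_le_tsum hle)
  have := ENNReal.tsum_lt_tsum hfin hle
    (i := t₀) (ENNReal.mul_lt_mul_right ((A.mem_support_iff _).1 ht₀) (A.apply_ne_top _)
      (hlt t₀ ht₀))
  rw [hsum] at this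
  exact absurd htot (not_le.2 this)

theorem exists_disjoint_clusters {k q r : ℕ} (h : q * r ≤ k) :
    ∃ I : Fin q → Finset (Fin k), (∀ j, (I j).card = r) ∧
      ∀ i, ∑ j, (if i ∈ I j then (1 : ℝ) else 0) ≤ 1 := by
  let e : Fin q × Fin r ↪ Fin k := finProdFinEquiv.toEmbedding.trans (Fin.castLEEmb h)
  refine ⟨fun j => Finset.univ.map ⟨fun s => e (j, s), fun s s' hs => by
    simpa using e.injective hs⟩, fun j => by simp, fun i => ?_⟩
  rw [Finset.sum_boole]
  norm_cast
  rw [Finset.card_le_one]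
  intro j hj j' hj'
  simp only [Finset.mem_filter, Finset.mem_map, Finset.mem_univ, true_and] at hj hj'
  obtain ⟨s, hs⟩ := hj
  obtain ⟨s', hs'⟩ := hj'
  exact congrArg Prod.fst (e.injective (hs.trans hs'.symm))

/-- If the tape laws cannot be distinguished then no algorithm finds an index. -/
theorem RandomizedAlgorithm.false_of_tape_indistinguishable {n k q r m T : ℕ}
    (A : RandomizedAlgorithm k n) (hA : A.UsesAtMost T) (hqr : q * r ≤ k) (hq : 60 ≤ q)
    (hm : 20 * T ≤ q * (m + 1)) {Ω : Type*} [Fintype Ω] [Nonempty Ω] (P Q : Ω → PMF (Fin n))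
    (hfind : ∀ (I : Finset (Fin k)) ω, I.card = r → A.FindsIndex I (P ω) (Q ω))
    (htv : ∀ G : (Fin m → Fin n) → (Fin T → Fin n) → ℝ,
      (∀ xs ys, 0 ≤ G xs ys ∧ G xs ys ≤ 1) →
      (∑ ω, tapeSum (fun x => (P ω x).toReal) m fun xs =>
          tapeSum (fun x => (Q ω x).toReal) T fun ys => G xs ys) ≤
        (∑ ω, tapeSum (fun x => (Q ω x).toReal) m fun xs =>
          tapeSum (fun x => (Q ω x).toReal) T fun ys => G xs ys) + Fintype.card Ω / 2) :
    False := by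
  obtain ⟨I, hIcard, hI⟩ := exists_disjoint_clusters hqr
  -- Averaging over the candidate as well as the prior gives one tree to which the bounds over all
  -- candidates apply simultaneously.
  obtain ⟨t, ht, hsucc⟩ := A.exists_tree (ι := Fin q × Ω) (fun a => I a.1) (fun a => P a.2)
    (fun a => Q a.2) fun a => hfind _ _ (hIcard _)
  have hdep := hA t ht
  choose G hG1 hG2 hG3 using fun j => t.exists_tape_test (I j) m m T le_rfl hdep
  have hΩ : (0 : ℝ) < Fintype.card Ω := by exact_mod_cast Fintype.card_pos
  have hm' : (0 : ℝ) < (m : ℝ) + 1 := by positivity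
  have h1 : ∀ j, ∑ ω, t.success (clusterInstance (I j) (P ω) (Q ω)) (I j) ≤
      ∑ ω, (t.success (fun _ => Q ω) (I j) +
        t.expQueries (fun _ => Q ω) (I j) / (m + 1)) + Fintype.card Ω / 2 := by
    intro j
    refine (Finset.sum_le_sum fun ω _ => hG2 j (P ω) (Q ω)).trans
      ((htv (G j) (hG1 j)).trans ?_)
    gcongr with ω
    simpa using hG3 j (Q ω)
  have h2 : ∑ j, ∑ ω, (t.success (fun _ => Q ω) (I j) +
      t.expQueries (fun _ => Q ω) (I j) / (m + 1)) ≤ Fintype.card Ω * (1 + T / (m + 1)) := by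
    rw [Finset.sum_comm]
    calc _ ≤ ∑ _ω : Ω, (1 + T / ((m : ℝ) + 1)) := Finset.sum_le_sum fun ω _ => by
          rw [Finset.sum_add_distrib, ← Finset.sum_div]
          gcongr
          · exact t.sum_success_le_one _ I hI
          · exact (t.sum_expQueries_le_depth _ I hI).trans (by exact_mod_cast hdep)
      _ = _ := by rw [Finset.sum_const, nsmul_eq_mul, Finset.card_univ]
  have h3 : (T : ℝ) / (m + 1) ≤ q / 20 := by
    rw [div_le_div_iff₀ hm' (by norm_num)]
    have : (20 * T : ℝ) ≤ q * (m + 1) := by exact_mod_cast hm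
    linarith
  have h4 : (60 : ℝ) ≤ q := by exact_mod_cast hq
  rw [Fintype.sum_prod_type] at hsucc
  have h5 := hsucc.trans (Finset.sum_le_sum fun j (_ : j ∈ Finset.univ) => h1 j)
  rw [Finset.sum_add_distrib] at h5
  simp only [Fintype.card_prod, Fintype.card_fin, Finset.sum_const, Finset.card_univ,
    nsmul_eq_mul, Nat.cast_mul] at h5
  have h6 : (Fintype.card Ω : ℝ) * (1 + T / (m + 1)) ≤ Fintype.card Ω * (1 + q / 20) := by gcongr
  -- Divided by the size of the prior, the inequalities read `0.9 q ≤ 1 + q/20 + q/2`, which is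
  -- false for `q ≥ 60`.
  nlinarith

/-! ### Second moment method for tests -/

/-- Second moment criterion: two weights whose difference is controlled in the `χ²` sense cannot be
distinguished by a test. -/
theorem sum_mul_test_le_of_sq_le {Y : Type*} [Fintype Y] (alt null h G : Y → ℝ)
    (hh : ∀ y, 0 ≤ h y) (hnull : ∀ y, 0 ≤ null y)
    (hsq : ∀ y, (alt y - null y) ^ 2 ≤ h y * null y) (hG : ∀ y, 0 ≤ G y ∧ G y ≤ 1) :
    ∑ y, alt y * G y ≤ ∑ y, null y * G y + (∑ y, h y + (∑ y, null y) / 4) := by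
  have hpt : ∀ y, alt y * G y ≤ null y * G y + (h y + null y / 4) := by
    intro y
    -- AM-GM: `h * null ≤ (h + null / 4) ^ 2`.
    have h1 : |alt y - null y| ≤ h y + null y / 4 := by
      apply abs_le_of_sq_le_sq (by nlinarith [hsq y, sq_nonneg (h y - null y / 4)])
      linarith [hh y, hnull y]
    have h2 : (alt y - null y) * G y ≤ |alt y - null y| * 1 :=
      (mul_le_mul_of_nonneg_right (le_abs_self _) (hG y).1).trans
        (mul_le_mul_of_nonneg_left (hG y).2 (abs_nonneg _))
    linarith
  refine (Finset.sum_le_sum fun y _ => hpt y).trans (le_of_eq ?_)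
  rw [Finset.sum_add_distrib, Finset.sum_add_distrib, Finset.sum_div]

/-- The law on `[n]` with prescribed real weights. -/
noncomputable def PMF.ofRealWeights {α : Type*} [Fintype α] (p : α → ℝ) (h0 : ∀ x, 0 ≤ p x)
    (h1 : ∑ x, p x = 1) : PMF α :=
  PMF.ofFintype (fun x => ENNReal.ofReal (p x)) (by
    rw [← ENNReal.ofReal_sum_of_nonneg fun x _ => h0 x, h1, ENNReal.ofReal_one])

theorem PMF.ofRealWeights_apply_toReal {α : Type*} [Fintype α] (p : α → ℝ) (h0 : ∀ x, 0 ≤ p x)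
    (h1 : ∑ x, p x = 1) (x : α) : (PMF.ofRealWeights p h0 h1 x).toReal = p x := by
  simp [PMF.ofRealWeights, ENNReal.toReal_ofReal (h0 x)]

theorem tapeSum_prod {α : Type*} [Fintype α] (u f : α → ℝ) (m : ℕ) :
    tapeSum u m (fun xs => ∏ s, f (xs s)) = (∑ x, u x * f x) ^ m := by
  rw [Fintype.sum_pow]
  unfold tapeSum
  simp only [Finset.prod_mul_distrib]

theorem tapeSum_mul_weight {α : Type*} [Fintype α] (u f : α → ℝ) (m : ℕ)
    (F : (Fin m → α) → ℝ) :
    tapeSum (fun x => u x * f x) m F = tapeSum u m (fun xs => (∏ s, f (xs s)) * F xs) := by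
  unfold tapeSum
  simp only [Finset.prod_mul_distrib, mul_assoc]

/-- Ingster's second moment method for a mixture of product laws. -/
theorem mixture_test_le {α Ω : Type*} [Fintype α] [Fintype Ω] [Nonempty Ω] (u : α → ℝ)
    (L : Ω → α → ℝ) (m : ℕ) (hu : ∀ x, 0 ≤ u x) (hu1 : ∑ x, u x = 1)
    (hL1 : ∀ ω, ∑ x, u x * L ω x = 1)
    (h2 : ∑ ω, ∑ ω', (∑ x, u x * (L ω x * L ω' x)) ^ m ≤ 5 / 4 * (Fintype.card Ω : ℝ) ^ 2)
    (G : (Fin m → α) → ℝ) (hG : ∀ xs, 0 ≤ G xs ∧ G xs ≤ 1) :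
    ∑ ω, tapeSum (fun x => u x * L ω x) m G ≤
      (Fintype.card Ω : ℝ) * tapeSum u m G + (Fintype.card Ω : ℝ) / 2 := by
  set W : ℝ := (Fintype.card Ω : ℝ) with hW
  have hWpos : 0 < W := by rw [hW]; exact_mod_cast Fintype.card_pos
  set R : (Fin m → α) → ℝ := fun xs => ∑ ω, ∏ s, L ω (xs s) with hR
  have hu' : ∀ xs : Fin m → α, 0 ≤ ∏ s, u (xs s) := fun xs => Finset.prod_nonneg fun _ _ => hu _
  have key := sum_mul_test_le_of_sq_le (fun xs : Fin m → α => (∏ s, u (xs s)) * R xs)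
    (fun xs => (∏ s, u (xs s)) * W) (fun xs => (∏ s, u (xs s)) * ((R xs - W) ^ 2 / W)) G
    (fun xs => mul_nonneg (hu' xs) (by positivity)) (fun xs => mul_nonneg (hu' xs) hWpos.le)
    (fun xs => le_of_eq (by field_simp)) hG
  have hside : ∑ xs : Fin m → α, (∏ s, u (xs s)) * ((R xs - W) ^ 2 / W) +
      (∑ xs : Fin m → α, (∏ s, u (xs s)) * W) / 4 ≤ W / 2 := by
    have e0 : ∑ xs : Fin m → α, (∏ s, u (xs s)) = 1 := by
      have := tapeSum_one u hu1 m 1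
      simpa [tapeSum] using this
    have e1 : ∑ xs : Fin m → α, (∏ s, u (xs s)) * R xs = W := by
      have : ∀ ω, tapeSum u m (fun xs => ∏ s, L ω (xs s)) = 1 := fun ω => by
        rw [tapeSum_prod, hL1, one_pow]
      calc _ = tapeSum u m (fun xs => ∑ ω, ∏ s, L ω (xs s)) := rfl
        _ = ∑ ω : Ω, (1 : ℝ) := by rw [← tapeSum_sum]; exact Finset.sum_congr rfl fun ω _ => this ω
        _ = W := by simp [hW]
    have e2 : ∑ xs : Fin m → α, (∏ s, u (xs s)) * R xs ^ 2 =
        ∑ ω, ∑ ω', (∑ x, u x * (L ω x * L ω' x)) ^ m := by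
      calc _ = tapeSum u m (fun xs => ∑ ω, ∑ ω', ∏ s, (L ω (xs s) * L ω' (xs s))) := by
            unfold tapeSum
            refine Finset.sum_congr rfl fun xs _ => ?_
            rw [hR, sq, Finset.sum_mul_sum]
            simp only [Finset.prod_mul_distrib]
        _ = _ := by
            simp only [← tapeSum_sum]
            exact Finset.sum_congr rfl fun ω _ => Finset.sum_congr rfl fun ω' _ =>
              tapeSum_prod u (fun x => L ω x * L ω' x) m
    have e3 : ∑ xs : Fin m → α, (∏ s, u (xs s)) * ((R xs - W) ^ 2 / W) =
        ((∑ xs : Fin m → α, (∏ s, u (xs s)) * R xs ^ 2) -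
          2 * W * (∑ xs : Fin m → α, (∏ s, u (xs s)) * R xs) +
          W ^ 2 * ∑ xs : Fin m → α, (∏ s, u (xs s))) / W := by
      rw [Finset.mul_sum, Finset.mul_sum, ← Finset.sum_sub_distrib, ← Finset.sum_add_distrib,
        Finset.sum_div]
      exact Finset.sum_congr rfl fun xs _ => by ring
    -- The χ² distance is at most `5/4 - 1`; together with the quarter from AM-GM this gives the
    -- `1/2`.
    have e4 : ∑ xs : Fin m → α, (∏ s, u (xs s)) * ((R xs - W) ^ 2 / W) ≤ W / 4 := by
      rw [e3, e2, e1, e0, div_le_iff₀ hWpos]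
      nlinarith
    rw [← Finset.sum_mul, e0]
    linarith
  have key' := key.trans (add_le_add le_rfl hside)
  have eL : ∑ ω, tapeSum (fun x => u x * L ω x) m G =
      ∑ xs : Fin m → α, (∏ s, u (xs s)) * R xs * G xs := by
    simp only [tapeSum_mul_weight, tapeSum_sum]
    unfold tapeSum
    refine Finset.sum_congr rfl fun xs _ => ?_
    rw [mul_assoc, hR, Finset.sum_mul]
  have eR : W * tapeSum u m G = ∑ xs : Fin m → α, (∏ s, u (xs s)) * W * G xs := by
    rw [tapeSum_mul]
    exact Finset.sum_congr rfl fun xs _ => by ring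
  rw [eL, eR]
  exact key'

/-! ### One known distribution: spiked blocks -/

/-- The likelihood ratio moving a fraction `a` of the mass of each block `j` to its position
`z j`; leftover elements are not changed. -/
def blockRatio {N b l : ℕ} (a : ℝ) (z : Fin N → Fin b) : (Fin N × Fin b) ⊕ Fin l → ℝ
  | .inl (j, p) => 1 + a * (b * (if p = z j then 1 else 0) - 1)
  | .inr _ => 1

theorem sum_spike {b : ℕ} (p₀ : Fin b) :
    ∑ p, ((b : ℝ) * (if p = p₀ then 1 else 0) - 1) = 0 := by
  rw [Finset.sum_sub_distrib, ← Finset.mul_sum]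
  simp

theorem sum_blockRatio {N b l : ℕ} (a : ℝ) (z : Fin N → Fin b) :
    ∑ s : (Fin N × Fin b) ⊕ Fin l, blockRatio a z s = N * b + l := by
  rw [Fintype.sum_sum_type, Fintype.sum_prod_type]
  simp only [blockRatio, Finset.sum_add_distrib, ← Finset.mul_sum, sum_spike]
  simp

theorem sum_spike_mul_spike {b : ℕ} (p₀ p₁ : Fin b) :
    ∑ p, ((b : ℝ) * (if p = p₀ then 1 else 0) - 1) * (b * (if p = p₁ then 1 else 0) - 1) =
      b * (b * (if p₁ = p₀ then 1 else 0) - 1) := by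
  have : ∀ p : Fin b, ((b : ℝ) * (if p = p₀ then 1 else 0) - 1) *
      (b * (if p = p₁ then 1 else 0) - 1) =
      (if p = p₁ then (b : ℝ) * (b * (if p₁ = p₀ then 1 else 0) - 1) else 0) -
        (b * (if p = p₀ then 1 else 0) - 1) := by
    intro p
    by_cases h : p = p₁
    · subst h; simp; ring
    · simp [h]
  simp only [this, Finset.sum_sub_distrib (f := fun p => if p = p₁ then _ else _), sum_spike]
  simp

/-- The spikes are centred in each block, so the linear terms vanish and the overlap depends only on
the number of blocks in which `z` and `z'` agree. -/
theorem sum_blockRatio_mul {N b l : ℕ} (a : ℝ) (z z' : Fin N → Fin b) :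
    ∑ s : (Fin N × Fin b) ⊕ Fin l, blockRatio a z s * blockRatio a z' s =
      N * b + l + a ^ 2 * b * ∑ j, ((b : ℝ) * (if z' j = z j then 1 else 0) - 1) := by
  rw [Fintype.sum_sum_type, Fintype.sum_prod_type]
  have : ∀ j, ∑ p, blockRatio (l := l) a z (.inl (j, p)) * blockRatio (l := l) a z' (.inl (j, p)) =
      b + a ^ 2 * b * ((b : ℝ) * (if z' j = z j then 1 else 0) - 1) := by
    intro j
    have e : ∀ p, blockRatio (l := l) a z (.inl (j, p)) * blockRatio (l := l) a z' (.inl (j, p)) =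
        1 + a * (b * (if p = z j then 1 else 0) - 1) + a * (b * (if p = z' j then 1 else 0) - 1) +
        a ^ 2 * (((b : ℝ) * (if p = z j then 1 else 0) - 1) *
          (b * (if p = z' j then 1 else 0) - 1)) := by
      intro p; simp only [blockRatio]; ring
    simp only [e, Finset.sum_add_distrib, ← Finset.mul_sum, sum_spike, sum_spike_mul_spike]
    simp
    ring
  rw [Finset.sum_congr rfl fun j _ => this j]
  simp only [blockRatio, Finset.sum_add_distrib, ← Finset.mul_sum]
  simp
  ring

theorem blockRatio_nonneg {N b l : ℕ} {a : ℝ} (ha0 : 0 ≤ a) (ha1 : a ≤ 1) (z : Fin N → Fin b)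
    (s : (Fin N × Fin b) ⊕ Fin l) : 0 ≤ blockRatio a z s := by
  rcases s with ⟨j, p⟩ | x
  · simp only [blockRatio]
    have : (0 : ℝ) ≤ b * (if p = z j then 1 else 0) := by positivity
    nlinarith
  · simp [blockRatio]

theorem sum_abs_blockRatio_sub_one {N b l : ℕ} {a : ℝ} (ha0 : 0 ≤ a) (hb : 1 ≤ b)
    (z : Fin N → Fin b) :
    ∑ s : (Fin N × Fin b) ⊕ Fin l, |blockRatio a z s - 1| = 2 * (a * N * (b - 1)) := by
  rw [Fintype.sum_sum_type, Fintype.sum_prod_type]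
  have hb' : (1 : ℝ) ≤ b := by exact_mod_cast hb
  have : ∀ j, ∑ p, |blockRatio (l := l) a z (.inl (j, p)) - 1| = 2 * (a * (b - 1)) := by
    intro j
    have e : ∀ p, |blockRatio (l := l) a z (.inl (j, p)) - 1| =
        a + (if p = z j then a * (b - 2) else 0) := by
      intro p
      simp only [blockRatio, add_sub_cancel_left, abs_mul, abs_of_nonneg ha0]
      split_ifs
      · rw [abs_of_nonneg (by linarith)]; ring
      · simp
    simp only [e, Finset.sum_add_distrib, Finset.sum_ite_eq', Finset.mem_univ, if_true]
    simp
    ring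
  rw [Finset.sum_congr rfl fun j _ => this j]
  simp [blockRatio]
  ring

/-- From `exp x ≤ 1 + x + x ^ 2` for `|x| ≤ 1`: the linear term sums to zero and the quadratic one
to `β ^ 2 * b * (b - 1)`. The condition `β * b ≤ 1` keeps the exponent in range. -/
theorem sum_exp_spike_le {b : ℕ} (hb : 1 ≤ b) {β : ℝ} (hβ : 0 ≤ β) (hβb : β * b ≤ 1)
    (p₀ : Fin b) :
    ∑ p, Real.exp (β * ((b : ℝ) * (if p = p₀ then 1 else 0) - 1)) ≤ b * Real.exp (β ^ 2 * b) := by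
  have hb' : (1 : ℝ) ≤ b := by exact_mod_cast hb
  have h1 : ∀ p : Fin b, Real.exp (β * ((b : ℝ) * (if p = p₀ then 1 else 0) - 1)) ≤
      1 + β * ((b : ℝ) * (if p = p₀ then 1 else 0) - 1) +
        β ^ 2 * (((b : ℝ) * (if p = p₀ then 1 else 0) - 1) *
          ((b : ℝ) * (if p = p₀ then 1 else 0) - 1)) := by
    intro p
    have habs : |β * ((b : ℝ) * (if p = p₀ then 1 else 0) - 1)| ≤ 1 := by
      rw [abs_le]
      split_ifs <;> constructor <;> nlinarith
    have := (abs_le.1 (Real.abs_exp_sub_one_sub_id_le habs)).2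
    nlinarith
  refine (Finset.sum_le_sum fun p _ => h1 p).trans ?_
  simp only [Finset.sum_add_distrib, ← Finset.mul_sum, sum_spike, sum_spike_mul_spike]
  simp only [Finset.sum_const, Finset.card_univ, Fintype.card_fin, nsmul_eq_mul, mul_one,
    if_true, mul_zero, add_zero]
  have := Real.add_one_le_exp (β ^ 2 * b)
  nlinarith [sq_nonneg β]

theorem exp_le_five_fourths {x : ℝ} (hx : x ≤ 1 / 5) : Real.exp x ≤ 5 / 4 := by
  have h1 : Real.exp x ≤ Real.exp (1 / 5) := Real.exp_le_exp.2 hx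
  have h2 := Real.one_sub_le_exp_neg (1 / 5)
  rw [Real.exp_neg] at h2
  have h3 := Real.exp_pos (1 / 5)
  have h4 : Real.exp (1 / 5) * (Real.exp (1 / 5))⁻¹ = 1 := mul_inv_cancel₀ h3.ne'
  nlinarith

/-- The second moment of the block mixture. -/
theorem sum_second_moment_block_le {n N b l m : ℕ} (hn : N * b + l = n) (hn0 : 0 < n)
    (hb : 1 ≤ b) {a : ℝ} (ha0 : 0 ≤ a) (ha1 : a ≤ 1) (hβb : m * a ^ 2 * b / n * b ≤ 1)
    (hβn : (m * a ^ 2 * b / n) ^ 2 * n ≤ 1 / 5) :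
    ∑ z : Fin N → Fin b, ∑ z' : Fin N → Fin b,
      (∑ s : (Fin N × Fin b) ⊕ Fin l, (1 / n : ℝ) * (blockRatio a z s * blockRatio a z' s)) ^ m ≤
      5 / 4 * (Fintype.card (Fin N → Fin b) : ℝ) ^ 2 := by
  set β : ℝ := m * a ^ 2 * b / n with hβ
  have hβ0 : 0 ≤ β := by positivity
  have hn' : (0 : ℝ) < n := by exact_mod_cast hn0
  have hnr : (N : ℝ) * b + l = n := by exact_mod_cast hn
  have h1 : ∀ z z' : Fin N → Fin b,
      (∑ s : (Fin N × Fin b) ⊕ Fin l, (1 / n : ℝ) * (blockRatio a z s * blockRatio a z' s)) ^ m ≤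
      ∏ j, Real.exp (β * ((b : ℝ) * (if z' j = z j then 1 else 0) - 1)) := by
    intro z z'
    have h0 : 0 ≤ ∑ s : (Fin N × Fin b) ⊕ Fin l,
        (1 / n : ℝ) * (blockRatio a z s * blockRatio a z' s) :=
      Finset.sum_nonneg fun s _ => mul_nonneg (by positivity)
        (mul_nonneg (blockRatio_nonneg ha0 ha1 z s) (blockRatio_nonneg ha0 ha1 z' s))
    rw [← Finset.mul_sum, sum_blockRatio_mul, hnr] at h0 ⊢
    have e : 1 / (n : ℝ) * (n + a ^ 2 * b * ∑ j, ((b : ℝ) * (if z' j = z j then 1 else 0) - 1)) =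
        (a ^ 2 * b / n) * (∑ j, ((b : ℝ) * (if z' j = z j then 1 else 0) - 1)) + 1 := by
      field_simp
      ring
    rw [e] at h0 ⊢
    refine (pow_le_pow_left₀ h0 (Real.add_one_le_exp _) m).trans (le_of_eq ?_)
    rw [← Real.exp_nat_mul, ← Real.exp_sum, ← Finset.mul_sum, hβ]
    congr 1
    ring
  -- For fixed `z` the coordinates of `z'` are independent, so the sum factors over blocks. The
  -- total exponent is at most `β² b N ≤ β² n ≤ 1/5`.
  have h2 : ∀ z : Fin N → Fin b, ∑ z' : Fin N → Fin b,
      ∏ j, Real.exp (β * ((b : ℝ) * (if z' j = z j then 1 else 0) - 1)) ≤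
      5 / 4 * Fintype.card (Fin N → Fin b) := by
    intro z
    have e := Finset.prod_univ_sum (fun _ : Fin N => (Finset.univ : Finset (Fin b)))
      (fun j p => Real.exp (β * ((b : ℝ) * (if p = z j then 1 else 0) - 1)))
    rw [Fintype.piFinset_univ] at e
    rw [← e]
    calc _ ≤ ∏ _j : Fin N, (b * Real.exp (β ^ 2 * b)) :=
          Finset.prod_le_prod (fun j _ => Finset.sum_nonneg fun p _ => (Real.exp_pos _).le)
            fun j _ => sum_exp_spike_le hb hβ0 hβb (z j)
      _ = (b : ℝ) ^ N * Real.exp (β ^ 2 * b * N) := by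
          rw [Finset.prod_const, Finset.card_univ, Fintype.card_fin, mul_pow, ← Real.exp_nat_mul]
          ring_nf
      _ ≤ (b : ℝ) ^ N * (5 / 4) := by
          gcongr
          apply exp_le_five_fourths
          refine le_trans ?_ hβn
          rw [mul_assoc]
          gcongr
          have : (0 : ℝ) ≤ l := Nat.cast_nonneg l
          linarith
      _ = _ := by simp [mul_comm]
  calc _ ≤ ∑ z : Fin N → Fin b, 5 / 4 * (Fintype.card (Fin N → Fin b) : ℝ) :=
        Finset.sum_le_sum fun z _ => (Finset.sum_le_sum fun z' _ => h1 z z').trans (h2 z)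
    _ = _ := by
        rw [Finset.sum_const, nsmul_eq_mul, Finset.card_univ]
        ring

theorem PMF.uniformOfFintype_fin_toReal {n : ℕ} [NeZero n] (x : Fin n) :
    (PMF.uniformOfFintype (Fin n) x).toReal = 1 / n := by
  simp [PMF.uniformOfFintype_apply]

/-- An algorithm for the known-uniform problem cannot succeed on the block mixture with too few
samples. -/
theorem RandomizedAlgorithm.SolvesOneKnown.false_of_blocks {n k q r m T N b : ℕ} [NeZero n]
    {A : RandomizedAlgorithm k n} {ε a : ℝ} (hsol : A.SolvesOneKnown r ε)
    (hA : A.UsesAtMost T) (hqr : q * r ≤ k) (hq : 60 ≤ q)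
    (hm : 20 * T ≤ q * (m + 1)) (hNb : N * b ≤ n)
    (hb : 1 ≤ b) (ha0 : 0 ≤ a) (ha1 : a ≤ 1) (hε : ε ≤ a * N * (b - 1) / n)
    (hβb : m * a ^ 2 * b / n * b ≤ 1) (hβn : (m * a ^ 2 * b / n) ^ 2 * n ≤ 1 / 5) : False := by
  have hn0 : 0 < n := Nat.pos_of_ne_zero (NeZero.ne n)
  have hn' : (0 : ℝ) < n := by exact_mod_cast hn0
  obtain ⟨l, hl⟩ := Nat.exists_eq_add_of_le hNb
  let E : Fin n ≃ (Fin N × Fin b) ⊕ Fin l := Fintype.equivOfCardEq (by simp [hl])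
  have hlr : (N : ℝ) * b + l = n := by exact_mod_cast hl.symm
  have hsum : ∀ f : (Fin N × Fin b) ⊕ Fin l → ℝ, ∑ x, f (E x) = ∑ s, f s := fun f =>
    Equiv.sum_comp E f
  let L : (Fin N → Fin b) → Fin n → ℝ := fun z x => blockRatio a z (E x)
  have hL0 : ∀ z x, 0 ≤ L z x := fun z x => blockRatio_nonneg ha0 ha1 z _
  have hL1 : ∀ z, ∑ x, (1 / n : ℝ) * L z x = 1 := by
    intro z
    rw [← Finset.mul_sum, hsum (blockRatio a z), sum_blockRatio, hlr]
    field_simp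
  let P : (Fin N → Fin b) → PMF (Fin n) := fun z => PMF.ofRealWeights (fun x => (1 / n : ℝ) * L z x)
    (fun x => mul_nonneg (by positivity) (hL0 z x)) (hL1 z)
  have hP : ∀ z x, (P z x).toReal = (1 / n : ℝ) * L z x := fun z x =>
    PMF.ofRealWeights_apply_toReal _ _ _ x
  have hbne : Nonempty (Fin b) := ⟨⟨0, hb⟩⟩
  refine A.false_of_tape_indistinguishable hA hqr hq hm P
    (fun _ => PMF.uniformOfFintype (Fin n)) (fun I z hI => hsol I (P z) hI ?_) fun G hG => ?_
  · refine hε.trans (le_of_eq ?_)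
    have e : ∀ x, |(1 / n : ℝ) * L z x - 1 / n| = (1 / n : ℝ) * |L z x - 1| := by
      intro x
      rw [← abs_of_pos (show (0 : ℝ) < 1 / n by positivity), ← abs_mul,
        abs_of_pos (show (0 : ℝ) < 1 / n by positivity)]
      ring_nf
    simp only [tvDist, hP, PMF.uniformOfFintype_fin_toReal, e, ← Finset.mul_sum]
    rw [hsum (fun s => |blockRatio a z s - 1|), sum_abs_blockRatio_sub_one ha0 hb]
    field_simp
  · simp only [hP, PMF.uniformOfFintype_fin_toReal]
    have hu1 : ∑ _x : Fin n, (1 / n : ℝ) = 1 := by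
      simp [hn'.ne']
    refine (mixture_test_le (fun _ : Fin n => (1 / n : ℝ)) L m (fun _ => by positivity) hu1 hL1 ?_
      (fun xs => tapeSum (fun _ => (1 / n : ℝ)) T fun ys => G xs ys) fun xs => ⟨?_, ?_⟩).trans
      (le_of_eq ?_)
    · simp only [L]
      refine le_trans (le_of_eq ?_)
        (sum_second_moment_block_le (m := m) hl.symm hn0 hb ha0 ha1 hβb hβn)
      refine Finset.sum_congr rfl fun z _ => Finset.sum_congr rfl fun z' _ => ?_
      rw [hsum (fun s => (1 / n : ℝ) * (blockRatio a z s * blockRatio a z' s))]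
    · exact Finset.sum_nonneg fun ys _ =>
        mul_nonneg (Finset.prod_nonneg fun _ _ => by positivity) (hG xs ys).1
    · refine le_trans ?_ (tapeSum_one (fun _ : Fin n => (1 / n : ℝ)) hu1 T 1).le
      exact Finset.sum_le_sum fun ys _ =>
        mul_le_mul_of_nonneg_left (hG xs ys).2 (Finset.prod_nonneg fun _ _ => by positivity)
    · rw [Finset.sum_const, nsmul_eq_mul, Finset.card_univ]

/-- Block sizes: all but a fraction `δ` of the elements lie off the chosen positions. -/
theorem exists_blocks {n B : ℕ} (hn : 2 ≤ n) (hB : 2 ≤ B) {ε δ : ℝ} (hBδ : 2 / δ ≤ B)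
    (hδ : 0 < δ) (hεδ : ε ≤ 1 - δ) (hεn : ε ≤ 1 - 1 / (n : ℝ)) :
    ∃ N b : ℕ, N * b ≤ n ∧ 2 ≤ b ∧ b ≤ B ^ 2 ∧ 1 ≤ N ∧ n ≤ 2 * (N * b) ∧
      ε * n ≤ N * (b - 1) := by
  have hn' : (0 : ℝ) < n := by exact_mod_cast (by omega : 0 < n)
  -- For small `n` a single block moves up to `1 - 1/n` of the mass, exactly what `hεn` allows. For
  -- larger `n`, blocks of size `B` waste a fraction `1/B` inside blocks and at most `1/B` on
  -- leftovers, which `2 / δ ≤ B` covers.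
  by_cases h : n ≤ B ^ 2
  · refine ⟨1, n, by simp, hn, h, le_rfl, by omega, ?_⟩
    have : ε * n ≤ (1 - 1 / (n : ℝ)) * n := by gcongr
    refine this.trans (le_of_eq ?_)
    field_simp
    simp
  · have hBn : B * B < n := by nlinarith
    have hB0 : 0 < B := by omega
    have h1 : n < B * (n / B) + B := by
      have := Nat.div_add_mod n B
      have := Nat.mod_lt n hB0
      omega
    have hN : B ≤ n / B := by rw [Nat.le_div_iff_mul_le hB0]; omega
    refine ⟨n / B, B, Nat.div_mul_le_self n B, hB, by nlinarith, by omega, ?_, ?_⟩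
    · rw [mul_comm (n / B)]
      nlinarith
    · have hBr : (0 : ℝ) < B := by exact_mod_cast hB0
      have h1r : (n : ℝ) ≤ B * (n / B : ℕ) + B := by exact_mod_cast h1.le
      have hBnr : (B : ℝ) * B ≤ n := by exact_mod_cast hBn.le
      have hδB : 2 ≤ δ * B := by rwa [div_le_iff₀' hδ] at hBδ
      have hB2 : (2 : ℝ) ≤ B := by exact_mod_cast hB
      have h3 : (1 - δ) * B ≤ B - 2 := by linarith
      have h4 : ε * n * B ≤ (B - 2) * n := by
        have : ε * n * B ≤ (1 - δ) * n * B := by gcongr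
        nlinarith
      have h5 : (B - 1) * ((n : ℝ) - B) ≤ (B - 1) * (B * (n / B : ℕ)) :=
        mul_le_mul_of_nonneg_left (by linarith) (by linarith)
      have h6 : (B : ℝ) * (ε * n) ≤ B * ((n / B : ℕ) * (B - 1)) := by nlinarith
      exact le_of_mul_le_mul_left h6 hBr

theorem div_nat_facts {k r : ℕ} (hr : 1 ≤ r) (hrk : (r : ℝ) ≤ (k : ℝ) / 60) :
    60 ≤ k / r ∧ k / r * r ≤ k ∧ (k : ℝ) / r ≤ 2 * (k / r : ℕ) := by
  have h60 : 60 * r ≤ k := by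
    have : (60 * r : ℝ) ≤ k := by linarith
    exact_mod_cast this
  have h1 : 60 ≤ k / r := (Nat.le_div_iff_mul_le hr).2 h60
  refine ⟨h1, Nat.div_mul_le_self k r, ?_⟩
  have hr' : (0 : ℝ) < r := by exact_mod_cast hr
  rw [div_le_iff₀ hr']
  have h2 : k < r * (k / r) + r := by
    have := Nat.div_add_mod k r
    have := Nat.mod_lt k (show 0 < r from hr)
    omega
  have h3 : k ≤ 2 * (k / r) * r := by nlinarith
  exact_mod_cast h3

/-- A tape of length `20 T / q` suffices for the indices of a typical cluster. -/
theorem tape_length_facts {k r T : ℕ} (hr : 1 ≤ r) (hrk : (r : ℝ) ≤ (k : ℝ) / 60) :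
    20 * T ≤ (k / r) * (20 * T / (k / r) + 1) ∧
      ((20 * T / (k / r) : ℕ) : ℝ) * ((k : ℝ) / r) ≤ 40 * T := by
  obtain ⟨h1, h2, h3⟩ := div_nat_facts hr hrk
  set q := k / r
  have hq : 0 < q := by omega
  constructor
  · have := Nat.div_add_mod (20 * T) q
    have := Nat.mod_lt (20 * T) hq
    nlinarith
  · have h4 : ((20 * T / q : ℕ) : ℝ) * q ≤ 20 * T := by
      exact_mod_cast Nat.div_mul_le_self (20 * T) q
    have : (0 : ℝ) ≤ ((20 * T / q : ℕ) : ℝ) := Nat.cast_nonneg _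
    nlinarith

set_option maxHeartbeats 1000000 in
-- The mass fraction `a = ε n / (N (b - 1))` puts `P` at distance exactly `ε`. Block sizes bounded
-- in terms of `δ` give `a ≤ 4ε`, so the two second moment conditions hold once `m ε²` is small
-- against `√n`.
theorem exists_one_known_constant (δ : ℝ) (hδ : 0 < δ) :
    ∃ c : ℝ, 0 < c ∧
      ∀ (n k r : ℕ) [NeZero n] (ε : ℝ),
        2 ≤ n → 1 ≤ r → (r : ℝ) ≤ (k : ℝ) / 60 → 0 < ε → ε ≤ 1 - δ →
        ∀ (A : RandomizedAlgorithm k n) (T : ℕ), A.UsesAtMost T →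
          ε ≤ 1 - 1 / (n : ℝ) → A.SolvesOneKnown r ε →
            c * ((k : ℝ) * Real.sqrt (n : ℝ) / ((r : ℝ) * ε ^ 2)) ≤ (T : ℝ) := by
  obtain ⟨B, hB⟩ := exists_nat_ge (max (2 / δ) 2)
  have hBδ : 2 / δ ≤ B := (le_max_left _ _).trans hB
  have hB2 : 2 ≤ B := by exact_mod_cast (le_max_right _ _).trans hB
  set M : ℝ := (B : ℝ) ^ 2 with hM
  have hM1 : 1 ≤ M := by
    have : (2 : ℝ) ≤ B := by exact_mod_cast hB2
    nlinarith
  -- With `m κ ≤ 40 T`, `a ≤ 4 ε` and `b ≤ M` this constant gives `β √n M ≤ 16 · 40 / 2000 ≤ 1/3`,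
  -- hence both `β b ≤ 1` and `β² n ≤ 1/9`.
  refine ⟨1 / (2000 * M ^ 2), by positivity, ?_⟩
  intro n k r _ ε hn hr hrk hε hεδ A T hA hεn hsol
  by_contra! hT
  obtain ⟨hq, hqr, -⟩ := div_nat_facts hr hrk
  obtain ⟨hm, hmT⟩ := tape_length_facts (T := T) hr hrk
  obtain ⟨N, b, hNb, hb, hbB, hN, hn2, hεN⟩ := exists_blocks hn hB2 hBδ hδ hεδ hεn
  set m := 20 * T / (k / r) with hmdef
  set κ : ℝ := (k : ℝ) / r with hκ
  have hr' : (0 : ℝ) < r := by exact_mod_cast hr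
  have hκ60 : 60 ≤ κ := by
    rw [hκ, le_div_iff₀ hr']
    linarith
  have hn' : (0 : ℝ) < n := by exact_mod_cast (by omega : 0 < n)
  have hs0 : 0 < Real.sqrt n := Real.sqrt_pos.2 hn'
  have hs1 : 1 ≤ Real.sqrt n := by
    rw [Real.one_le_sqrt]; exact_mod_cast (by omega : 1 ≤ n)
  have hss : Real.sqrt n * Real.sqrt n = n := Real.mul_self_sqrt hn'.le
  have hbr : (2 : ℝ) ≤ b := by exact_mod_cast hb
  have hbM : (b : ℝ) ≤ M := by rw [hM]; exact_mod_cast hbB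
  have hNr : (1 : ℝ) ≤ N := by exact_mod_cast hN
  have hn2r : (n : ℝ) ≤ 2 * (N * b) := by exact_mod_cast hn2
  have hD : 0 < (N : ℝ) * (b - 1) := by nlinarith
  set a : ℝ := ε * n / (N * (b - 1)) with ha
  have ha0 : 0 ≤ a := by positivity
  have ha1 : a ≤ 1 := by rw [ha, div_le_one hD]; exact hεN
  have ha4 : a ≤ 4 * ε := by
    rw [ha, div_le_iff₀ hD]
    have : (n : ℝ) ≤ 4 * (N * (b - 1)) := by nlinarith
    nlinarith
  have hmε : m * ε ^ 2 ≤ 40 * (1 / (2000 * M ^ 2)) * Real.sqrt n := by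
    have e : (k : ℝ) * Real.sqrt n / (r * ε ^ 2) = κ * Real.sqrt n / ε ^ 2 := by
      rw [hκ]; field_simp
    rw [e, mul_div_assoc', lt_div_iff₀ (by positivity)] at hT
    have h1 : (m * ε ^ 2) * κ ≤ (40 * (1 / (2000 * M ^ 2)) * Real.sqrt n) * κ := by
      have : (m * κ) * ε ^ 2 ≤ 40 * T * ε ^ 2 := by gcongr
      nlinarith
    exact le_of_mul_le_mul_right h1 (by linarith)
  set β : ℝ := m * a ^ 2 * b / n with hβ
  have hβ0 : 0 ≤ β := by positivity
  have hy : β * Real.sqrt n * M ≤ 1 / 3 := by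
    have h1 : m * a ^ 2 ≤ 16 * (m * ε ^ 2) := by
      have : a ^ 2 ≤ (4 * ε) ^ 2 := by gcongr
      calc m * a ^ 2 ≤ m * (4 * ε) ^ 2 := by gcongr
        _ = _ := by ring
    have h2 : m * a ^ 2 * M ^ 2 ≤ 16 / 50 * Real.sqrt n := by
      calc m * a ^ 2 * M ^ 2 ≤ 16 * (40 * (1 / (2000 * M ^ 2)) * Real.sqrt n) * M ^ 2 := by
            refine mul_le_mul_of_nonneg_right ?_ (sq_nonneg M)
            linarith
        _ = _ := by field_simp; norm_num
    have h3 : β * Real.sqrt n * M = m * a ^ 2 * (b * M) / Real.sqrt n := by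
      rw [hβ, div_mul_eq_mul_div, div_mul_eq_mul_div, div_eq_div_iff hn'.ne' hs0.ne']
      linear_combination m * a ^ 2 * b * M * hss
    rw [h3, div_le_iff₀ hs0]
    have h4 : m * a ^ 2 * (b * M) ≤ m * a ^ 2 * M ^ 2 := by
      rw [sq M]
      gcongr
    linarith
  have hy1 : β * Real.sqrt n ≤ 1 / 3 := by
    refine le_trans ?_ hy
    exact le_mul_of_one_le_right (by positivity) hM1
  refine hsol.false_of_blocks hA hqr hq hm hNb (by omega) ha0 ha1 ?_ ?_ ?_
  · have : a * N * (b - 1) = ε * n := by rw [mul_assoc, ha, div_mul_cancel₀ _ hD.ne']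
    rw [le_div_iff₀ hn', this]
  · calc β * b ≤ β * Real.sqrt n * M := by
          rw [mul_assoc]
          exact mul_le_mul_of_nonneg_left (by nlinarith) hβ0
      _ ≤ 1 := by linarith
  · have : β ^ 2 * n = (β * Real.sqrt n) ^ 2 := by rw [mul_pow, sq (Real.sqrt n), hss]
    rw [this]
    have : 0 ≤ β * Real.sqrt n := by positivity
    nlinarith

/-! ### Posterior of the hidden heavy set -/

/-- The weight of a set `θ` of heavy blocks when block `j` was observed `c j` times. -/
def heavyWeight {N : ℕ} (η lam : ℝ) (c : Fin N → ℕ) (θ : Finset (Fin N)) : ℝ :=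
  ∏ j, (if j ∈ θ then η else lam) ^ c j

theorem heavyWeight_pos {N : ℕ} {η lam : ℝ} (hη : 0 < η) (hlam : 0 < lam) (c : Fin N → ℕ)
    (θ : Finset (Fin N)) : 0 < heavyWeight η lam c θ :=
  Finset.prod_pos fun j _ => pow_pos (by split_ifs <;> assumption) _

/-- The block `h` was never seen, so making it light costs nothing; only the factor of `j` changes,
from `lam` to `η`. -/
theorem heavyWeight_swap {N : ℕ} {η lam : ℝ} (hη : 0 < η) (c : Fin N → ℕ)
    {θ : Finset (Fin N)} {j h : Fin N} (hj : j ∉ θ) (hh : h ∈ θ) (hc : c h = 0) :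
    heavyWeight η lam c θ = (lam / η) ^ c j * heavyWeight η lam c (insert j (θ.erase h)) := by
  unfold heavyWeight
  rw [← Finset.mul_prod_erase _ _ (Finset.mem_univ j),
    ← Finset.mul_prod_erase univ (fun i => (if i ∈ insert j (θ.erase h) then η else lam) ^ c i)
      (Finset.mem_univ j)]
  have e : ∏ i ∈ univ.erase j, (if i ∈ insert j (θ.erase h) then η else lam) ^ c i =
      ∏ i ∈ univ.erase j, (if i ∈ θ then η else lam) ^ c i := by
    refine Finset.prod_congr rfl fun i hi => ?_
    by_cases hih : i = h
    · subst hih; simp [hc]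
    · simp [Finset.ne_of_mem_erase hi, hih]
  rw [e]
  simp only [hj, if_false, Finset.mem_insert_self, if_true, div_pow]
  field_simp

/-- A block is light with small posterior odds: it can be exchanged with an unseen heavy block. -/
theorem sum_heavyWeight_insert_le {N K M : ℕ} {η lam : ℝ} (hη : 0 < η) (hlam : 0 < lam)
    (c : Fin N → ℕ) (hM : (univ.filter fun j => c j ≠ 0).card ≤ M) (hMK : 2 * M ≤ K) (hK : 0 < K)
    (A : Finset (Fin N)) (j : Fin N) (hjA : j ∉ A) :
    ∑ θ ∈ powersetCard K univ with Disjoint (insert j A) θ, heavyWeight η lam c θ ≤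
      (lam / η) ^ c j * (2 * N / K) *
        ∑ θ ∈ powersetCard K univ with Disjoint A θ, heavyWeight η lam c θ := by
  set W := heavyWeight η lam c with hW
  have hW0 : ∀ θ, 0 ≤ W θ := fun θ => (heavyWeight_pos hη hlam c θ).le
  have hratio : 0 ≤ (lam / η) ^ c j := by positivity
  set S : ℝ := ∑ θ ∈ powersetCard K univ with Disjoint A θ, W θ with hS
  have hKr : (0 : ℝ) < K := by exact_mod_cast hK
  -- At most `M ≤ K / 2` blocks were seen, so at least half of every candidate heavy set is
  -- available for an exchange.
  have hunseen : ∀ θ ∈ powersetCard K (univ : Finset (Fin N)),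
      (K : ℝ) / 2 ≤ (θ.filter fun h => c h = 0).card := by
    intro θ hθ
    have h1 := Finset.card_filter_add_card_filter_not (s := θ) (fun h => c h = 0)
    have h2 : (θ.filter fun h => ¬ c h = 0).card ≤ M :=
      (Finset.card_le_card (Finset.filter_subset_filter _ (Finset.subset_univ θ))).trans hM
    rw [(Finset.mem_powersetCard.1 hθ).2] at h1
    have h3 : K ≤ 2 * (θ.filter fun h => c h = 0).card := by omega
    have h4 : (K : ℝ) ≤ 2 * (θ.filter fun h => c h = 0).card := by exact_mod_cast h3
    linarith
  have hfix : ∀ h : Fin N, c h = 0 →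
      ∑ θ ∈ powersetCard K univ with Disjoint (insert j A) θ ∧ h ∈ θ, W θ ≤
        (lam / η) ^ c j * S := by
    intro h hch
    have e : ∀ θ ∈ (powersetCard K univ).filter fun θ => Disjoint (insert j A) θ ∧ h ∈ θ,
        W θ = (lam / η) ^ c j * W (insert j (θ.erase h)) := by
      intro θ hθ
      simp only [Finset.mem_filter, Finset.disjoint_insert_left] at hθ
      exact heavyWeight_swap hη c hθ.2.1.1 hθ.2.2 hch
    rw [Finset.sum_congr rfl e, ← Finset.mul_sum]
    refine mul_le_mul_of_nonneg_left ?_ hratio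
    have hinj : Set.InjOn (fun θ : Finset (Fin N) => insert j (θ.erase h))
        ((powersetCard K univ).filter fun θ => Disjoint (insert j A) θ ∧ h ∈ θ) := by
      intro θ hθ θ' hθ' heq
      simp only [Finset.coe_filter, Set.mem_ofPred_eq, Finset.disjoint_insert_left] at hθ hθ'
      have h1 := congrArg (fun s => insert h (s.erase j)) heq
      have h2 : ∀ θ : Finset (Fin N), j ∉ θ → h ∈ θ →
          insert h ((insert j (θ.erase h)).erase j) = θ := by
        intro θ hj hh
        rw [Finset.erase_insert (fun hm => hj (Finset.mem_of_mem_erase hm)),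
          Finset.insert_erase hh]
      simpa only [h2 θ hθ.2.1.1 hθ.2.2, h2 θ' hθ'.2.1.1 hθ'.2.2] using h1
    rw [← Finset.sum_image (f := W) hinj]
    refine Finset.sum_le_sum_of_subset_of_nonneg ?_ fun θ _ _ => hW0 θ
    intro θ' hθ'
    simp only [Finset.mem_image, Finset.mem_filter, Finset.mem_powersetCard,
      Finset.disjoint_insert_left] at hθ'
    obtain ⟨θ, ⟨⟨-, hcard⟩, ⟨hj, hdis⟩, hh⟩, rfl⟩ := hθ'
    simp only [Finset.mem_filter, Finset.mem_powersetCard, Finset.subset_univ, true_and,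
      Finset.disjoint_insert_right]
    refine ⟨?_, hjA, Finset.disjoint_of_subset_right (Finset.erase_subset h θ) hdis⟩
    rw [Finset.card_insert_of_notMem (fun hm => hj (Finset.mem_of_mem_erase hm)),
      Finset.card_erase_of_mem hh]
    omega
  -- Double counting of the pairs of a set `θ` and an unseen `h ∈ θ`: at least `K / 2` choices of
  -- `h` for each `θ`, and at most `N` values of `h` overall.
  have hdouble : (K : ℝ) / 2 * ∑ θ ∈ powersetCard K univ with Disjoint (insert j A) θ, W θ ≤
      N * ((lam / η) ^ c j * S) := by
    calc _ ≤ ∑ θ ∈ powersetCard K univ with Disjoint (insert j A) θ,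
          ∑ _h ∈ θ.filter (fun h => c h = 0), W θ := by
          rw [Finset.mul_sum]
          refine Finset.sum_le_sum fun θ hθ => ?_
          rw [Finset.sum_const, nsmul_eq_mul]
          exact mul_le_mul_of_nonneg_right (hunseen θ (Finset.mem_filter.1 hθ).1) (hW0 θ)
      _ = ∑ h with c h = 0,
          ∑ θ ∈ powersetCard K univ with Disjoint (insert j A) θ ∧ h ∈ θ, W θ := by
          refine Finset.sum_comm' fun θ h => ?_
          simp only [Finset.mem_filter, Finset.mem_univ, true_and]
          tauto
      _ ≤ ∑ h : Fin N with c h = 0, (lam / η) ^ c j * S :=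
          Finset.sum_le_sum fun h hh => hfix h (Finset.mem_filter.1 hh).2
      _ ≤ N * ((lam / η) ^ c j * S) := by
          rw [Finset.sum_const, nsmul_eq_mul]
          have h1 : ((univ.filter fun h : Fin N => c h = 0).card : ℝ) ≤ N := by
            exact_mod_cast (Finset.card_le_univ _).trans (by simp)
          have h2 : 0 ≤ S := Finset.sum_nonneg fun θ _ => hW0 θ
          exact mul_le_mul_of_nonneg_right h1 (mul_nonneg hratio h2)
  have e : (lam / η) ^ c j * (2 * N / K) * S = 2 / K * (N * ((lam / η) ^ c j * S)) := by
    field_simp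
  rw [e]
  calc _ = 2 / (K : ℝ) *
        (K / 2 * ∑ θ ∈ powersetCard K univ with Disjoint (insert j A) θ, W θ) := by field_simp
    _ ≤ _ := mul_le_mul_of_nonneg_left hdouble (by positivity)

/-- Removing the blocks of `A` one at a time shows that the events of being light are dominated by
independent ones, although the heavy set has fixed size. -/
theorem sum_heavyWeight_disjoint_le {N K M : ℕ} {η lam : ℝ} (hη : 0 < η) (hlam : 0 < lam)
    (c : Fin N → ℕ) (hM : (univ.filter fun j => c j ≠ 0).card ≤ M) (hMK : 2 * M ≤ K) (hK : 0 < K)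
    (A : Finset (Fin N)) :
    ∑ θ ∈ powersetCard K univ with Disjoint A θ, heavyWeight η lam c θ ≤
      (∏ j ∈ A, ((lam / η) ^ c j * (2 * N / K))) *
        ∑ θ ∈ powersetCard K univ, heavyWeight η lam c θ := by
  induction A using Finset.induction_on with
  | empty => simp
  | insert j A hj ih =>
    rw [Finset.prod_insert hj, mul_assoc]
    refine (sum_heavyWeight_insert_le hη hlam c hM hMK hK A j hj).trans ?_
    exact mul_le_mul_of_nonneg_left ih (by positivity)

/-- Posterior second moment: products over blocks that are light in two independent posterior
samples are dominated by products of independent factors. -/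
theorem sum_heavyWeight_pair_le {N K M : ℕ} {η lam : ℝ} (hη : 0 < η) (hlam : 0 < lam)
    (c : Fin N → ℕ) (hM : (univ.filter fun j => c j ≠ 0).card ≤ M) (hMK : 2 * M ≤ K) (hK : 0 < K)
    (φ : Fin N → ℝ) (hφ : ∀ j, 1 ≤ φ j) :
    ∑ θ ∈ powersetCard K univ, ∑ θ' ∈ powersetCard K univ,
      heavyWeight η lam c θ * heavyWeight η lam c θ' *
        ∏ j, (if j ∉ θ ∧ j ∉ θ' then φ j else 1) ≤
      (∏ j, (1 + (φ j - 1) * ((lam / η) ^ c j * (2 * N / K)) ^ 2)) *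
        (∑ θ ∈ powersetCard K univ, heavyWeight η lam c θ) ^ 2 := by
  set W := heavyWeight η lam c with hW
  have hW0 : ∀ θ, 0 ≤ W θ := fun θ => (heavyWeight_pos hη hlam c θ).le
  set F := powersetCard K (univ : Finset (Fin N)) with hF
  -- Write `φ j = 1 + (φ j - 1)` and expand over the sets `A` of blocks light in both draws. The
  -- coefficients are nonnegative and the sum over `(θ, θ')` becomes a square, so the bound for one
  -- draw applies termwise.
  have hexp : ∀ θ θ' : Finset (Fin N), ∏ j, (if j ∉ θ ∧ j ∉ θ' then φ j else 1) =
      ∑ A : Finset (Fin N), (∏ j ∈ A, (φ j - 1)) *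
        ((if Disjoint A θ then 1 else 0) * (if Disjoint A θ' then 1 else 0)) := by
    intro θ θ'
    have h1 : ∀ j, (if j ∉ θ ∧ j ∉ θ' then φ j else 1) =
        1 + (if j ∉ θ ∧ j ∉ θ' then φ j - 1 else 0) := fun j => by split_ifs <;> ring
    simp only [h1]
    rw [Finset.prod_one_add, Finset.powerset_univ]
    refine Finset.sum_congr rfl fun A _ => ?_
    rw [Finset.prod_ite_zero]
    have h2 : (∀ j ∈ A, j ∉ θ ∧ j ∉ θ') ↔ Disjoint A θ ∧ Disjoint A θ' := by
      simp only [Finset.disjoint_left]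
      exact ⟨fun h => ⟨fun j hj => (h j hj).1, fun j hj => (h j hj).2⟩,
        fun h j hj => ⟨h.1 hj, h.2 hj⟩⟩
    by_cases hd : Disjoint A θ <;> by_cases hd' : Disjoint A θ' <;> simp [h2, hd, hd']
  have hψ : ∀ A : Finset (Fin N), 0 ≤ ∏ j ∈ A, (φ j - 1) := fun A =>
    Finset.prod_nonneg fun j _ => by linarith [hφ j]
  calc ∑ θ ∈ F, ∑ θ' ∈ F, W θ * W θ' * ∏ j, (if j ∉ θ ∧ j ∉ θ' then φ j else 1)
      = ∑ A : Finset (Fin N), (∏ j ∈ A, (φ j - 1)) * (∑ θ ∈ F with Disjoint A θ, W θ) ^ 2 := by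
        simp only [hexp, Finset.mul_sum]
        rw [Finset.sum_congr rfl fun θ _ => Finset.sum_comm, Finset.sum_comm]
        refine Finset.sum_congr rfl fun A _ => ?_
        rw [Finset.sum_filter, sq, Finset.sum_mul_sum, Finset.mul_sum]
        refine Finset.sum_congr rfl fun θ _ => ?_
        rw [Finset.mul_sum]
        refine Finset.sum_congr rfl fun θ' _ => ?_
        split_ifs <;> ring
    _ ≤ ∑ A : Finset (Fin N), (∏ j ∈ A, (φ j - 1)) *
          ((∏ j ∈ A, ((lam / η) ^ c j * (2 * N / K))) * ∑ θ ∈ F, W θ) ^ 2 := by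
        refine Finset.sum_le_sum fun A _ => mul_le_mul_of_nonneg_left ?_ (hψ A)
        exact pow_le_pow_left₀ (Finset.sum_nonneg fun θ _ => hW0 θ)
          (sum_heavyWeight_disjoint_le hη hlam c hM hMK hK A) 2
    _ = _ := by
        rw [Finset.prod_one_add, Finset.powerset_univ, Finset.sum_mul]
        refine Finset.sum_congr rfl fun A _ => ?_
        rw [mul_pow, ← Finset.prod_pow, ← mul_assoc, ← Finset.prod_mul_distrib]

/-! ### Repetitions and operations on tapes -/

/-- The number of entries of `u` that equal `j`. -/
def occurrences {α : Type*} [DecidableEq α] {m : ℕ} (u : Fin m → α) (j : α) : ℕ :=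
  (univ.filter fun s => u s = j).card

theorem prod_comp_eq_prod_pow_occurrences {α : Type*} [DecidableEq α] [Fintype α] {m : ℕ}
    (u : Fin m → α) (f : α → ℝ) : ∏ s, f (u s) = ∏ j, f j ^ occurrences u j := by
  rw [← Finset.prod_fiberwise' univ u f]
  simp [occurrences, Finset.prod_const]

theorem occurrences_cons {α : Type*} [DecidableEq α] {m : ℕ} (x : α) (u : Fin m → α) (j : α) :
    occurrences (Fin.cons x u : Fin (m + 1) → α) j =
      occurrences u j + if x = j then 1 else 0 := by
  unfold occurrences
  rw [Fin.card_filter_univ_succ]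
  simp only [Fin.cons_zero, Fin.cons_succ]
  split_ifs <;> simp

theorem card_occurrences_ne_zero_le {α : Type*} [DecidableEq α] [Fintype α] {m : ℕ}
    (u : Fin m → α) : (univ.filter fun j => occurrences u j ≠ 0).card ≤ m := by
  have h : (univ.filter fun j => occurrences u j ≠ 0) ⊆ univ.image u := by
    intro j hj
    simp only [occurrences, Finset.mem_filter, Finset.mem_univ, true_and, ne_eq,
      Finset.card_eq_zero, ← Finset.nonempty_iff_ne_empty] at hj
    obtain ⟨s, hs⟩ := hj
    exact Finset.mem_image.2 ⟨s, Finset.mem_univ _, (Finset.mem_filter.1 hs).2⟩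
  exact (Finset.card_le_card h).trans (Finset.card_image_le.trans (by simp))

/-- The number of repetitions in a sample has light exponential moments. -/
theorem tapeSum_repetitions_le {α : Type*} [DecidableEq α] [Fintype α] (q : α → ℝ) {μ ρ : ℝ}
    (hq0 : ∀ x, 0 ≤ q x) (hqμ : ∀ x, q x ≤ μ) (hq1 : ∑ x, q x = 1) (hρ : 0 ≤ ρ) (M : ℕ) :
    ∀ m ≤ M, tapeSum q m (fun u => ∏ j, (1 + ρ) ^ (occurrences u j - 1)) ≤
      (1 + ρ * M * μ) ^ m := by
  intro m
  induction m with
  | zero => intro _; simp [tapeSum_zero, occurrences]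
  | succ m ih =>
    intro hm
    have hμ : 0 ≤ μ := by
      by_contra! hneg
      have : ∑ x, q x ≤ 0 := Finset.sum_nonpos fun x _ => (hqμ x).trans hneg.le
      linarith
    have hstep : ∀ u : Fin m → α, ∑ x, q x *
        ∏ j, (1 + ρ) ^ (occurrences (Fin.cons x u : Fin (m + 1) → α) j - 1) ≤
        (1 + ρ * M * μ) * ∏ j, (1 + ρ) ^ (occurrences u j - 1) := by
      intro u
      -- A new sample gains a factor `1 + ρ` only if its value was already seen, since truncated
      -- subtraction ignores first occurrences. At most `M` values have been seen, each of mass at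
      -- most `μ`.
      have e : ∀ x, ∏ j, (1 + ρ) ^ (occurrences (Fin.cons x u : Fin (m + 1) → α) j - 1) =
          (∏ j, (1 + ρ) ^ (occurrences u j - 1)) *
            (1 + if occurrences u x ≠ 0 then ρ else 0) := by
        intro x
        rw [← Finset.mul_prod_erase univ _ (Finset.mem_univ x),
          ← Finset.mul_prod_erase univ (fun j => (1 + ρ) ^ (occurrences u j - 1))
            (Finset.mem_univ x)]
        have e1 : ∏ j ∈ univ.erase x,
            (1 + ρ) ^ (occurrences (Fin.cons x u : Fin (m + 1) → α) j - 1) =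
            ∏ j ∈ univ.erase x, (1 + ρ) ^ (occurrences u j - 1) := by
          refine Finset.prod_congr rfl fun j hj => ?_
          rw [occurrences_cons, if_neg (Finset.ne_of_mem_erase hj).symm, add_zero]
        rw [e1, occurrences_cons, if_pos rfl]
        rcases hmu : occurrences u x with _ | y
        · simp
        · simp [pow_succ]
          ring
      simp only [e]
      have hP : 0 ≤ ∏ j, (1 + ρ) ^ (occurrences u j - 1) :=
        Finset.prod_nonneg fun j _ => by positivity
      have e2 : ∀ x, q x * ((∏ j, (1 + ρ) ^ (occurrences u j - 1)) *
            (1 + if occurrences u x ≠ 0 then ρ else 0)) =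
          (∏ j, (1 + ρ) ^ (occurrences u j - 1)) *
            (q x + if occurrences u x ≠ 0 then q x * ρ else 0) := by
        intro x
        split_ifs <;> ring
      simp only [e2]
      rw [← Finset.mul_sum, mul_comm]
      refine mul_le_mul_of_nonneg_right ?_ hP
      rw [Finset.sum_add_distrib, hq1, ← Finset.sum_filter]
      refine add_le_add le_rfl ?_
      calc ∑ x with occurrences u x ≠ 0, q x * ρ
          ≤ ∑ x with occurrences u x ≠ 0, μ * ρ :=
            Finset.sum_le_sum fun x _ => mul_le_mul_of_nonneg_right (hqμ x) hρ
        _ = ((univ.filter fun x => occurrences u x ≠ 0).card : ℝ) * (μ * ρ) := by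
            rw [Finset.sum_const, nsmul_eq_mul]
        _ ≤ M * (μ * ρ) := by
            refine mul_le_mul_of_nonneg_right ?_ (by positivity)
            exact_mod_cast (card_occurrences_ne_zero_le u).trans (by omega)
        _ = ρ * M * μ := by ring
    rw [tapeSum_succ]
    simp only [tapeSum_mul, tapeSum_sum]
    calc _ ≤ tapeSum q m (fun u => (1 + ρ * M * μ) * ∏ j, (1 + ρ) ^ (occurrences u j - 1)) :=
          Finset.sum_le_sum fun u _ =>
            mul_le_mul_of_nonneg_left (hstep u) (Finset.prod_nonneg fun _ _ => hq0 _)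
      _ ≤ (1 + ρ * M * μ) * (1 + ρ * M * μ) ^ m := by
          rw [← tapeSum_mul]
          exact mul_le_mul_of_nonneg_left (ih (by omega)) (by positivity)
      _ = _ := by ring

theorem tapeSum_prod_eq {β : Type*} [Fintype β] (r : β → ℝ) (m : ℕ) (f : Fin m → β → ℝ) :
    tapeSum r m (fun p => ∏ s, f s (p s)) = ∏ s, ∑ x, r x * f s x := by
  rw [Finset.prod_univ_sum, Fintype.piFinset_univ]
  unfold tapeSum
  simp only [Finset.prod_mul_distrib]

theorem tapeSum_pair {α β : Type*} [Fintype α] [Fintype β] (q : α → ℝ) (r : β → ℝ) (m : ℕ)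
    (F : (Fin m → α × β) → ℝ) :
    tapeSum (fun x : α × β => q x.1 * r x.2) m F =
      tapeSum q m fun u => tapeSum r m fun p => F fun s => (u s, p s) := by
  unfold tapeSum
  rw [← (Equiv.arrowProdEquivProdArrow (Fin m) (fun _ => α) (fun _ => β)).symm.sum_comp,
    Fintype.sum_prod_type]
  refine Finset.sum_congr rfl fun u _ => ?_
  rw [Finset.mul_sum]
  refine Finset.sum_congr rfl fun p _ => ?_
  simp [Equiv.arrowProdEquivProdArrow, Finset.prod_mul_distrib, mul_assoc]

theorem tapeSum_comp_injective {α β : Type*} [Fintype α] [Fintype β] (e : β → α)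
    (he : Function.Injective e) (p : α → ℝ) (p' : β → ℝ) (hp : ∀ s, p (e s) = p' s)
    (hp0 : ∀ x, x ∉ Set.range e → p x = 0) (m : ℕ) (F : (Fin m → α) → ℝ) :
    tapeSum p m F = tapeSum p' m fun xs => F fun s => e (xs s) := by
  unfold tapeSum
  symm
  refine Fintype.sum_of_injective (fun (xs : Fin m → β) s => e (xs s))
    (fun xs ys h => funext fun s => he (congrFun h s)) _ _ (fun xs hxs => ?_) fun xs => ?_
  · have : ∃ s, xs s ∉ Set.range e := by
      by_contra! hcon
      choose ys hys using hcon
      exact hxs ⟨ys, funext hys⟩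
    obtain ⟨s, hs⟩ := this
    rw [Finset.prod_eq_zero (Finset.mem_univ s) (hp0 _ hs), zero_mul]
  · simp only [hp]

/-! ### Spikes in the light blocks, conditionally on the block labels -/

/-- The likelihood ratio that moves the mass of every light block `j ∉ θ` to its position `z j`. -/
def lightSpike {N b : ℕ} (θ : Finset (Fin N)) (z : Fin N → Fin b) (j : Fin N) (p : Fin b) : ℝ :=
  if j ∈ θ then 1 else b * (if p = z j then 1 else 0)

theorem sum_lightSpike {N b : ℕ} (hb : 1 ≤ b) (θ : Finset (Fin N)) (z : Fin N → Fin b)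
    (j : Fin N) : ∑ p, (1 / b : ℝ) * lightSpike θ z j p = 1 := by
  have hb' : (b : ℝ) ≠ 0 := by exact_mod_cast (by omega : b ≠ 0)
  unfold lightSpike
  by_cases h : j ∈ θ <;> simp [h, hb']

theorem sum_lightSpike_mul {N b : ℕ} (hb : 1 ≤ b) (θ θ' : Finset (Fin N)) (z z' : Fin N → Fin b)
    (j : Fin N) : ∑ p, (1 / b : ℝ) * (lightSpike θ z j p * lightSpike θ' z' j p) =
      if j ∉ θ ∧ j ∉ θ' then (b : ℝ) * (if z' j = z j then 1 else 0) else 1 := by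
  have hb' : (b : ℝ) ≠ 0 := by exact_mod_cast (by omega : b ≠ 0)
  unfold lightSpike
  by_cases h : j ∈ θ <;> by_cases h' : j ∈ θ'
  · simp [h, h', hb']
  · simp [h, h', hb']
  · simp [h, h', hb']
  · have : ∀ p, (1 / b : ℝ) * ((b * (if p = z j then 1 else 0)) * (b * (if p = z' j then 1 else 0))) =
        if p = z' j then b * (if z' j = z j then 1 else 0) else 0 := by
      intro p
      by_cases hp : p = z' j
      · subst hp; simp; field_simp
      · simp [hp]
    simp only [h, h', if_false, this]
    simp

/-- A block light in both draws contributes only when `z' j = z j`, a fraction `1/b` of all choices,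
and then `b` for each occurrence. Truncated subtraction gives the correct value `1` for an unseen
block. -/
theorem sum_lightSpike_second_moment {N b m : ℕ} (hb : 1 ≤ b) (θ θ' : Finset (Fin N))
    (u : Fin m → Fin N) (z : Fin N → Fin b) :
    ∑ z' : Fin N → Fin b, tapeSum (fun _ : Fin b => (1 / b : ℝ)) m
        (fun p => ∏ s, (lightSpike θ z (u s) (p s) * lightSpike θ' z' (u s) (p s))) =
      (b : ℝ) ^ N * ∏ j, (if j ∉ θ ∧ j ∉ θ' then (b : ℝ) ^ (occurrences u j - 1) else 1) := by
  have h1 : ∀ z' : Fin N → Fin b, tapeSum (fun _ : Fin b => (1 / b : ℝ)) m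
        (fun p => ∏ s, (lightSpike θ z (u s) (p s) * lightSpike θ' z' (u s) (p s))) =
      ∏ j, (if j ∉ θ ∧ j ∉ θ' then (b : ℝ) * (if z' j = z j then 1 else 0) else 1) ^
        occurrences u j := by
    intro z'
    rw [tapeSum_prod_eq (fun _ : Fin b => (1 / b : ℝ)) m
      fun s p => lightSpike θ z (u s) p * lightSpike θ' z' (u s) p]
    simp only [sum_lightSpike_mul hb]
    exact prod_comp_eq_prod_pow_occurrences u
      fun j => if j ∉ θ ∧ j ∉ θ' then (b : ℝ) * (if z' j = z j then 1 else 0) else 1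
  simp only [h1]
  have e := Finset.prod_univ_sum (fun _ : Fin N => (Finset.univ : Finset (Fin b)))
    (fun j p => (if j ∉ θ ∧ j ∉ θ' then (b : ℝ) * (if p = z j then 1 else 0) else 1) ^
        occurrences u j)
  rw [Fintype.piFinset_univ] at e
  rw [← e]
  have h2 : (b : ℝ) ^ N = ∏ _j : Fin N, (b : ℝ) := by simp
  rw [h2, ← Finset.prod_mul_distrib]
  refine Finset.prod_congr rfl fun j _ => ?_
  split_ifs with h
  · rcases hocc : occurrences u j with _ | x
    · simp
    · simp only [mul_pow, ite_pow, one_pow, zero_pow (Nat.succ_ne_zero x)]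
      simp [pow_succ, mul_comm]
  · simp

/-- Conditionally on the observed blocks, the positions inside the blocks cannot be used to tell
the spiked law from the flat one if two posterior samples of the heavy set rarely agree. -/
theorem position_test_le {N b m : ℕ} (hb : 1 ≤ b) (F : Finset (Finset (Fin N)))
    (w : Finset (Fin N) → ℝ) (hw : 0 < ∑ θ ∈ F, w θ) (u : Fin m → Fin N) {Φ : ℝ}
    (hΦ : ∑ θ ∈ F, ∑ θ' ∈ F, w θ * w θ' *
        ∏ j, (if j ∉ θ ∧ j ∉ θ' then (b : ℝ) ^ (occurrences u j - 1) else 1) ≤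
      Φ * (∑ θ ∈ F, w θ) ^ 2)
    (g : (Fin m → Fin b) → ℝ) (hg : ∀ p, 0 ≤ g p ∧ g p ≤ 1) :
    ∑ θ ∈ F, ∑ z : Fin N → Fin b, w θ * tapeSum (fun _ : Fin b => (1 / b : ℝ)) m
        (fun p => (∏ s, lightSpike θ z (u s) (p s)) * g p) ≤
      (b : ℝ) ^ N * ((∑ θ ∈ F, w θ) * tapeSum (fun _ : Fin b => (1 / b : ℝ)) m g) +
        (b : ℝ) ^ N * ((∑ θ ∈ F, w θ) * (Φ - 1 + 1 / 4)) := by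
  set W := ∑ θ ∈ F, w θ with hWdef
  set Z : ℝ := (b : ℝ) ^ N with hZ
  have hb' : (0 : ℝ) < b := by exact_mod_cast hb
  have hZ0 : 0 < Z := by positivity
  have hZW : 0 < Z * W := mul_pos hZ0 hw
  have hcard : ∑ _z : Fin N → Fin b, (1 : ℝ) = Z := by simp [hZ]
  set r : Fin b → ℝ := fun _ => (1 / b : ℝ) with hr
  have hr1 : ∑ x, r x = 1 := by simp [hr, hb'.ne']
  set X : (Fin m → Fin b) → ℝ := fun p =>
    ∑ θ ∈ F, ∑ z : Fin N → Fin b, w θ * ∏ s, lightSpike θ z (u s) (p s) with hX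
  have hβ : ∀ p : Fin m → Fin b, 0 ≤ ∏ s, r (p s) := fun p =>
    Finset.prod_nonneg fun _ _ => by simp [hr]
  have e0 : ∑ p : Fin m → Fin b, (∏ s, r (p s)) = 1 := by
    simpa [tapeSum] using tapeSum_one r hr1 m 1
  have e1 : tapeSum r m X = Z * W := by
    have : ∀ θ (z : Fin N → Fin b),
        tapeSum r m (fun p => ∏ s, lightSpike θ z (u s) (p s)) = 1 := by
      intro θ z
      rw [tapeSum_prod_eq r m fun s p => lightSpike θ z (u s) p]
      simp only [hr, sum_lightSpike hb, Finset.prod_const_one]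
    simp only [hX, ← tapeSum_sum, ← tapeSum_mul, this]
    simp only [← Finset.mul_sum, hcard]
    rw [← Finset.sum_mul, mul_comm]
  -- Squaring introduces a second independent pair `(θ', z')`. Summing out the positions and `z'`
  -- leaves exactly the sum over pairs of heavy sets controlled by `hΦ`.
  have e2 : tapeSum r m (fun p => X p ^ 2) ≤ Z ^ 2 * (Φ * W ^ 2) := by
    have hsq : ∀ p, X p ^ 2 = ∑ θ ∈ F, ∑ z : Fin N → Fin b, ∑ θ' ∈ F, ∑ z' : Fin N → Fin b,
        (w θ * w θ') * ∏ s, (lightSpike θ z (u s) (p s) * lightSpike θ' z' (u s) (p s)) := by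
      intro p
      simp only [hX, sq, Finset.sum_mul, Finset.mul_sum, Finset.prod_mul_distrib]
      refine Finset.sum_congr rfl fun θ _ => Finset.sum_congr rfl fun z _ =>
        Finset.sum_congr rfl fun θ' _ => Finset.sum_congr rfl fun z' _ => ?_
      ring
    simp only [hsq, ← tapeSum_sum, ← tapeSum_mul]
    have : ∀ (θ θ' : Finset (Fin N)) (z : Fin N → Fin b), ∑ z' : Fin N → Fin b,
        w θ * w θ' * tapeSum r m
          (fun p => ∏ s, (lightSpike θ z (u s) (p s) * lightSpike θ' z' (u s) (p s))) =
        Z * (w θ * w θ' *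
          ∏ j, (if j ∉ θ ∧ j ∉ θ' then (b : ℝ) ^ (occurrences u j - 1) else 1)) := by
      intro θ θ' z
      rw [← Finset.mul_sum, sum_lightSpike_second_moment hb]
      ring
    simp only [this]
    have e : ∀ θ, ∑ _z : Fin N → Fin b, ∑ θ' ∈ F, Z * (w θ * w θ' *
          ∏ j, (if j ∉ θ ∧ j ∉ θ' then (b : ℝ) ^ (occurrences u j - 1) else 1)) =
        Z ^ 2 * ∑ θ' ∈ F, w θ * w θ' *
          ∏ j, (if j ∉ θ ∧ j ∉ θ' then (b : ℝ) ^ (occurrences u j - 1) else 1) := by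
      intro θ
      rw [Finset.sum_const, ← Finset.mul_sum, Finset.card_univ, nsmul_eq_mul]
      have : (Fintype.card (Fin N → Fin b) : ℝ) = Z := by simp [hZ]
      rw [this]
      ring
    simp only [e]
    rw [← Finset.mul_sum]
    exact mul_le_mul_of_nonneg_left hΦ (by positivity)
  clear_value W
  have key := sum_mul_test_le_of_sq_le (fun p : Fin m → Fin b => (∏ s, r (p s)) * X p)
    (fun p => (∏ s, r (p s)) * (Z * W))
    (fun p => (∏ s, r (p s)) * ((X p - Z * W) ^ 2 / (Z * W))) g
    (fun p => mul_nonneg (hβ p) (by positivity)) (fun p => mul_nonneg (hβ p) hZW.le)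
    (fun p => le_of_eq (by field_simp)) hg
  have e3 : ∑ p : Fin m → Fin b, (∏ s, r (p s)) * ((X p - Z * W) ^ 2 / (Z * W)) =
      (tapeSum r m (fun p => X p ^ 2) - 2 * (Z * W) * tapeSum r m X +
        (Z * W) ^ 2 * ∑ p : Fin m → Fin b, (∏ s, r (p s))) / (Z * W) := by
    unfold tapeSum
    rw [Finset.mul_sum, Finset.mul_sum, ← Finset.sum_sub_distrib, ← Finset.sum_add_distrib,
      Finset.sum_div]
    exact Finset.sum_congr rfl fun xs _ => by ring
  have e4 : ∑ p : Fin m → Fin b, (∏ s, r (p s)) * ((X p - Z * W) ^ 2 / (Z * W)) ≤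
      Z * W * (Φ - 1) := by
    rw [e3, e1, e0, div_le_iff₀ hZW]
    nlinarith
  rw [← Finset.sum_mul, e0] at key
  have hl : ∑ θ ∈ F, ∑ z : Fin N → Fin b, w θ * tapeSum r m
        (fun p => (∏ s, lightSpike θ z (u s) (p s)) * g p) =
      ∑ p : Fin m → Fin b, (∏ s, r (p s)) * X p * g p := by
    simp only [tapeSum_mul, tapeSum_sum]
    unfold tapeSum
    refine Finset.sum_congr rfl fun p _ => ?_
    rw [mul_assoc, hX]
    simp only [Finset.sum_mul, mul_assoc]
  have hrr : Z * (W * tapeSum r m g) = ∑ p : Fin m → Fin b, (∏ s, r (p s)) * (Z * W) * g p := by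
    unfold tapeSum
    simp only [Finset.mul_sum]
    exact Finset.sum_congr rfl fun p _ => by ring
  rw [hl, hrr]
  linarith

/-! ### Masking of light collisions by heavy blocks -/

/-- Mass of a block: `η` if it is heavy and `lam` if it is light. -/
def blockMass {N : ℕ} (η lam : ℝ) (θ : Finset (Fin N)) (j : Fin N) : ℝ :=
  if j ∈ θ then η else lam

/-- Both tapes reveal information about `θ`, so its posterior depends on the combined counts,
although only the first tape carries spikes. -/
theorem prod_blockMass_mul {N m T : ℕ} (η lam : ℝ) (θ : Finset (Fin N)) (u : Fin m → Fin N)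
    (v : Fin T → Fin N) :
    (∏ s, blockMass η lam θ (u s)) * ∏ s, blockMass η lam θ (v s) =
      heavyWeight η lam (fun j => occurrences u j + occurrences v j) θ := by
  rw [prod_comp_eq_prod_pow_occurrences, prod_comp_eq_prod_pow_occurrences,
    ← Finset.prod_mul_distrib]
  exact Finset.prod_congr rfl fun j _ => (pow_add _ _ _).symm

/-- A block with `x ≥ 2` occurrences in the first tape costs at most `b^(x-1) (Λ^x D)² = (bΛ²)^(x-2)
· bΛ⁴D² ≤ ρ`, with `Λ = lam/η` and `D = 2N/K`; a block seen at most once there costs nothing. Extra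
occurrences in the second tape only help, since `Λ ≤ 1`. -/
theorem sum_heavyWeight_blocks_le {N K b m T : ℕ} {η lam ρ : ℝ} (hη : 0 < η) (hlam : 0 < lam)
    (hle : lam ≤ η) (hb : 1 ≤ b) (hmK : 2 * (m + T) ≤ K) (hK : 0 < K)
    (h1 : b * (lam / η) ^ 2 ≤ 1) (hρ : b * (lam / η) ^ 4 * (2 * N / K) ^ 2 ≤ ρ)
    (u : Fin m → Fin N) (v : Fin T → Fin N) :
    ∑ θ ∈ powersetCard K univ, ∑ θ' ∈ powersetCard K univ,
      heavyWeight η lam (fun j => occurrences u j + occurrences v j) θ *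
        heavyWeight η lam (fun j => occurrences u j + occurrences v j) θ' *
        ∏ j, (if j ∉ θ ∧ j ∉ θ' then (b : ℝ) ^ (occurrences u j - 1) else 1) ≤
      (∏ j, (1 + ρ) ^ (occurrences u j - 1)) * (∑ θ ∈ powersetCard K univ,
        heavyWeight η lam (fun j => occurrences u j + occurrences v j) θ) ^ 2 := by
  have hb' : (1 : ℝ) ≤ b := by exact_mod_cast hb
  have hρ0 : 0 ≤ ρ := le_trans (by positivity) hρ
  have hM : (univ.filter fun j => occurrences u j + occurrences v j ≠ 0).card ≤ m + T := by
    have hsub : (univ.filter fun j => occurrences u j + occurrences v j ≠ 0) ⊆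
        (univ.filter fun j => occurrences u j ≠ 0) ∪ (univ.filter fun j => occurrences v j ≠ 0) := by
      intro j
      simp only [Finset.mem_filter, Finset.mem_union, Finset.mem_univ, true_and]
      omega
    exact (Finset.card_le_card hsub).trans ((Finset.card_union_le _ _).trans
      (add_le_add (card_occurrences_ne_zero_le u) (card_occurrences_ne_zero_le v)))
  refine (sum_heavyWeight_pair_le hη hlam _ hM hmK hK _
    fun j => one_le_pow₀ (n := occurrences u j - 1) hb').trans ?_
  refine mul_le_mul_of_nonneg_right (Finset.prod_le_prod (fun j _ => ?_) fun j _ => ?_)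
    (sq_nonneg _)
  · have : (1 : ℝ) ≤ (b : ℝ) ^ (occurrences u j - 1) := one_le_pow₀ hb'
    have : 0 ≤ ((b : ℝ) ^ (occurrences u j - 1) - 1) *
      ((lam / η) ^ (occurrences u j + occurrences v j) * (2 * N / K)) ^ 2 :=
      mul_nonneg (by linarith) (sq_nonneg _)
    linarith
  · set Λ := lam / η with hΛ
    have hΛ0 : 0 ≤ Λ := by positivity
    have hΛ1 : Λ ≤ 1 := by rw [hΛ, div_le_one hη]; exact hle
    set D : ℝ := 2 * N / K with hD
    rcases hx : occurrences u j with _ | _ | x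
    · simp
    · simp
    · have e1 : (Λ ^ (x + 1 + 1 + occurrences v j)) ≤ Λ ^ (x + 2) :=
        pow_le_pow_of_le_one hΛ0 hΛ1 (by omega)
      have e2 : ((b : ℝ) * Λ ^ 2) ^ x ≤ 1 := pow_le_one₀ (by positivity) h1
      have e3 : ((b : ℝ) ^ (x + 1) - 1) * (Λ ^ (x + 1 + 1 + occurrences v j) * D) ^ 2 ≤ ρ := by
        calc _ ≤ (b : ℝ) ^ (x + 1) * (Λ ^ (x + 2) * D) ^ 2 := by
              refine mul_le_mul (by linarith) ?_ (sq_nonneg _) (by positivity)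
              refine pow_le_pow_left₀ (by positivity) ?_ 2
              exact mul_le_mul_of_nonneg_right e1 (by positivity)
          _ = ((b : ℝ) * Λ ^ 2) ^ x * (b * Λ ^ 4 * D ^ 2) := by ring
          _ ≤ 1 * (b * Λ ^ 4 * D ^ 2) := mul_le_mul_of_nonneg_right e2 (by positivity)
          _ ≤ ρ := by linarith
      have e4 : 1 + ρ ≤ (1 + ρ) ^ (x + 1) := le_self_pow₀ (by linarith) (by omega)
      simp only [add_tsub_cancel_right]
      linarith

/-- Samples from the spiked laws are indistinguishable from samples of the flat law: the collisions
in light blocks are masked by the heavy blocks. -/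
theorem masked_test_le {N K b m T : ℕ} {η lam ρ : ℝ} (hη : 0 < η) (hlam : 0 < lam)
    (hle : lam ≤ η) (hb : 1 ≤ b) (hKN : K ≤ N) (hmK : 2 * (m + T) ≤ K) (hK : 0 < K)
    (hmass : ∀ θ ∈ powersetCard K (univ : Finset (Fin N)), ∑ j, blockMass η lam θ j = 1)
    (h1 : b * (lam / η) ^ 2 ≤ 1) (hρ : b * (lam / η) ^ 4 * (2 * N / K) ^ 2 ≤ ρ)
    (hfin : (1 + ρ * m * η) ^ m ≤ 5 / 4)
    (G : (Fin m → Fin N × Fin b) → (Fin T → Fin N × Fin b) → ℝ)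
    (hG : ∀ xs ys, 0 ≤ G xs ys ∧ G xs ys ≤ 1) :
    ∑ θ ∈ powersetCard K univ, ∑ z : Fin N → Fin b,
      tapeSum (fun x => blockMass η lam θ x.1 * (1 / b) * lightSpike θ z x.1 x.2) m (fun xs =>
        tapeSum (fun x => blockMass η lam θ x.1 * (1 / b)) T fun ys => G xs ys) ≤
    (∑ θ ∈ powersetCard K univ, ∑ _z : Fin N → Fin b,
      tapeSum (fun x => blockMass η lam θ x.1 * (1 / b)) m (fun xs =>
        tapeSum (fun x => blockMass η lam θ x.1 * (1 / b)) T fun ys => G xs ys)) +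
      ((powersetCard K (univ : Finset (Fin N))).card * (b : ℝ) ^ N) / 2 := by
  set F := powersetCard K (univ : Finset (Fin N)) with hF
  have hFne : F.Nonempty := by
    rw [hF, Finset.powersetCard_nonempty]
    simpa using hKN
  set Z : ℝ := (b : ℝ) ^ N with hZ
  have hb' : (0 : ℝ) < b := by exact_mod_cast hb
  have hρ0 : 0 ≤ ρ := le_trans (by positivity) hρ
  set r : Fin b → ℝ := fun _ => (1 / b : ℝ) with hr
  have hr0 : ∀ x, 0 ≤ r x := fun _ => by simp [hr]
  have hr1 : ∑ x, r x = 1 := by simp [hr, hb'.ne']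
  set w : (Fin m → Fin N) → (Fin T → Fin N) → Finset (Fin N) → ℝ := fun u v θ =>
    heavyWeight η lam (fun j => occurrences u j + occurrences v j) θ with hw
  have hwpos : ∀ u v θ, 0 < w u v θ := fun u v θ => heavyWeight_pos hη hlam _ θ
  set g : (Fin m → Fin N) → (Fin T → Fin N) → (Fin m → Fin b) → ℝ := fun u v p =>
    tapeSum r T fun p' => G (fun s => (u s, p s)) fun s => (v s, p' s) with hg
  have hg01 : ∀ u v p, 0 ≤ g u v p ∧ g u v p ≤ 1 := by
    intro u v p
    constructor
    · exact Finset.sum_nonneg fun p' _ =>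
        mul_nonneg (Finset.prod_nonneg fun s _ => hr0 (p' s)) (hG _ _).1
    · refine le_trans ?_ (tapeSum_one r hr1 T 1).le
      exact Finset.sum_le_sum fun p' _ =>
        mul_le_mul_of_nonneg_left (hG _ _).2 (Finset.prod_nonneg fun s _ => hr0 (p' s))
  -- Conditioning on the block labels `u, v`, which have the same joint law with and without spikes;
  -- the positions in the second tape are integrated into the test `g`.
  have hsplit : ∀ (θ : Finset (Fin N)) (L : (Fin m → Fin N) → (Fin m → Fin b) → ℝ),
      (tapeSum (blockMass η lam θ) m fun u => tapeSum r m fun p => L u p *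
        tapeSum (blockMass η lam θ) T fun v => tapeSum r T fun p' =>
          G (fun s => (u s, p s)) fun s => (v s, p' s)) =
      ∑ u, ∑ v, w u v θ * tapeSum r m fun p => L u p * g u v p := by
    intro θ L
    have h2 : ∀ u, (tapeSum r m fun p => L u p *
        tapeSum (blockMass η lam θ) T fun v => tapeSum r T fun p' =>
          G (fun s => (u s, p s)) fun s => (v s, p' s)) =
        ∑ v, (∏ s, blockMass η lam θ (v s)) * tapeSum r m fun p => L u p * g u v p := by
      intro u
      calc _ = tapeSum r m fun p =>
            ∑ v, (∏ s, blockMass η lam θ (v s)) * (L u p * g u v p) := by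
            congr 1
            funext p
            conv_lhs => rw [tapeSum, Finset.mul_sum]
            exact Finset.sum_congr rfl fun v _ => by simp only [hg]; ring
        _ = _ := by
            rw [← tapeSum_sum]
            exact Finset.sum_congr rfl fun v _ => (tapeSum_mul _ _ _ _).symm
    simp only [h2]
    conv_lhs => rw [tapeSum]
    refine Finset.sum_congr rfl fun u _ => ?_
    rw [Finset.mul_sum]
    refine Finset.sum_congr rfl fun v _ => ?_
    rw [← mul_assoc, prod_blockMass_mul]
  have hpair : ∀ (θ : Finset (Fin N)) (H : (Fin T → Fin N × Fin b) → ℝ),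
      tapeSum (fun x => blockMass η lam θ x.1 * (1 / b)) T H =
        tapeSum (blockMass η lam θ) T fun v => tapeSum r T fun p' => H fun s => (v s, p' s) :=
    fun θ H => tapeSum_pair (blockMass η lam θ) r T H
  have halt : ∀ θ (z : Fin N → Fin b),
      tapeSum (fun x => blockMass η lam θ x.1 * (1 / b) * lightSpike θ z x.1 x.2) m (fun xs =>
        tapeSum (fun x : Fin N × Fin b => blockMass η lam θ x.1 * (1 / b)) T fun ys => G xs ys) =
      ∑ u, ∑ v, w u v θ * tapeSum r m fun p =>
        (∏ s, lightSpike θ z (u s) (p s)) * g u v p := by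
    intro θ z
    rw [← hsplit θ fun u p => ∏ s, lightSpike θ z (u s) (p s),
      tapeSum_mul_weight (fun x : Fin N × Fin b => blockMass η lam θ x.1 * (1 / b))
        (fun x => lightSpike θ z x.1 x.2), tapeSum_pair (blockMass η lam θ) r]
    simp only [hpair]
  have hnull : ∀ θ,
      tapeSum (fun x : Fin N × Fin b => blockMass η lam θ x.1 * (1 / b)) m (fun xs =>
        tapeSum (fun x : Fin N × Fin b => blockMass η lam θ x.1 * (1 / b)) T fun ys => G xs ys) =
      ∑ u, ∑ v, w u v θ * tapeSum r m (g u v) := by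
    intro θ
    have := hsplit θ fun _ _ => 1
    simp only [one_mul] at this
    rw [← this, tapeSum_pair (blockMass η lam θ) r]
    simp only [hpair]
  simp only [halt, hnull]
  have hZc : ∀ c : ℝ, ∑ _z : Fin N → Fin b, c = Z * c := by
    intro c
    rw [Finset.sum_const, Finset.card_univ, nsmul_eq_mul]
    simp [hZ]
  set Φ : (Fin m → Fin N) → ℝ := fun u => ∏ j, (1 + ρ) ^ (occurrences u j - 1) with hΦ
  have hpos : ∀ u v, ∑ θ ∈ F, ∑ z : Fin N → Fin b, w u v θ * (tapeSum r m fun p =>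
        (∏ s, lightSpike θ z (u s) (p s)) * g u v p) ≤
      Z * ((∑ θ ∈ F, w u v θ) * tapeSum r m (g u v)) +
        Z * ((∑ θ ∈ F, w u v θ) * (Φ u - 1 + 1 / 4)) := fun u v =>
    position_test_le hb F (w u v) (Finset.sum_pos (fun θ _ => hwpos u v θ) hFne) u
      (sum_heavyWeight_blocks_le hη hlam hle hb hmK hK h1 hρ u v) (g u v) (hg01 u v)
  have hq0 : ∀ (θ : Finset (Fin N)) j, 0 ≤ blockMass η lam θ j := fun θ j => by
    simp only [blockMass]; split_ifs <;> linarith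
  have hqη : ∀ (θ : Finset (Fin N)) j, blockMass η lam θ j ≤ η := fun θ j => by
    simp only [blockMass]; split_ifs <;> linarith
  -- Averaged over the labels, the conditional error is at most `5/4 - 1 + 1/4 = 1/2`, by the
  -- exponential moment of the number of repetitions.
  have hrest : ∀ θ ∈ F, ∑ u, ∑ v, w u v θ * (Φ u - 1 + 1 / 4) ≤ 1 / 2 := by
    intro θ hθ
    have e : ∀ u, ∑ v, w u v θ * (Φ u - 1 + 1 / 4) =
        (∏ s, blockMass η lam θ (u s)) * Φ u +
          (∏ s, blockMass η lam θ (u s)) * (-1 + 1 / 4) := by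
      intro u
      have h2 := tapeSum_one (blockMass η lam θ) (hmass θ hθ) T 1
      simp only [tapeSum, mul_one] at h2
      simp only [hw, ← prod_blockMass_mul]
      rw [← Finset.sum_mul, ← Finset.mul_sum, h2]
      ring
    simp only [e, Finset.sum_add_distrib]
    have h3 : ∑ u, (∏ s, blockMass η lam θ (u s)) * Φ u ≤ 5 / 4 :=
      (tapeSum_repetitions_le (blockMass η lam θ) (hq0 θ) (hqη θ) (hmass θ hθ) hρ0 m m le_rfl).trans hfin
    have h4 : ∑ u : Fin m → Fin N, (∏ s, blockMass η lam θ (u s)) * (-1 + 1 / 4) = -1 + 1 / 4 :=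
      tapeSum_one (blockMass η lam θ) (hmass θ hθ) m _
    linarith
  have hswap : ∀ f : Finset (Fin N) → (Fin N → Fin b) → (Fin m → Fin N) → (Fin T → Fin N) → ℝ,
      ∑ θ ∈ F, ∑ z, ∑ u, ∑ v, f θ z u v = ∑ u, ∑ v, ∑ θ ∈ F, ∑ z, f θ z u v := by
    intro f
    calc _ = ∑ θ ∈ F, ∑ u, ∑ v, ∑ z, f θ z u v := by
          refine Finset.sum_congr rfl fun θ _ => ?_
          rw [Finset.sum_comm]
          exact Finset.sum_congr rfl fun u _ => Finset.sum_comm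
      _ = _ := by
          rw [Finset.sum_comm]
          exact Finset.sum_congr rfl fun u _ => Finset.sum_comm
  rw [hswap, hswap]
  have htot : ∑ u, ∑ v, Z * ((∑ θ ∈ F, w u v θ) * (Φ u - 1 + 1 / 4)) ≤ F.card * Z / 2 := by
    have : ∑ u, ∑ v, Z * ((∑ θ ∈ F, w u v θ) * (Φ u - 1 + 1 / 4)) =
        Z * ∑ θ ∈ F, ∑ u, ∑ v, w u v θ * (Φ u - 1 + 1 / 4) := by
      simp only [← Finset.mul_sum, Finset.sum_mul]
      congr 1
      rw [Finset.sum_comm]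
      calc _ = ∑ u, ∑ θ ∈ F, ∑ v, w u v θ * (Φ u - 1 + 1 / 4) := by
            rw [Finset.sum_comm]
            exact Finset.sum_congr rfl fun u _ => Finset.sum_comm
        _ = _ := by rw [Finset.sum_comm]
    rw [this]
    calc _ ≤ Z * ∑ θ ∈ F, (1 / 2 : ℝ) :=
          mul_le_mul_of_nonneg_left (Finset.sum_le_sum hrest) (by positivity)
      _ = _ := by rw [Finset.sum_const, nsmul_eq_mul]; ring
  calc _ ≤ ∑ u, ∑ v, (Z * ((∑ θ ∈ F, w u v θ) * tapeSum r m (g u v)) +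
        Z * ((∑ θ ∈ F, w u v θ) * (Φ u - 1 + 1 / 4))) :=
        Finset.sum_le_sum fun u _ => Finset.sum_le_sum fun v _ => hpos u v
    _ = ∑ u, ∑ v, Z * ((∑ θ ∈ F, w u v θ) * tapeSum r m (g u v)) +
        ∑ u, ∑ v, Z * ((∑ θ ∈ F, w u v θ) * (Φ u - 1 + 1 / 4)) := by
        simp only [Finset.sum_add_distrib]
    _ ≤ _ := by
        refine add_le_add (le_of_eq ?_) htot
        refine Finset.sum_congr rfl fun u _ => Finset.sum_congr rfl fun v _ => ?_
        simp only [hZc]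
        rw [← Finset.mul_sum, Finset.sum_mul]

theorem sum_blockMass {N K : ℕ} (η lam : ℝ) {θ : Finset (Fin N)}
    (hθ : θ ∈ powersetCard K (univ : Finset (Fin N))) :
    ∑ j, blockMass η lam θ j = K * η + (N - K) * lam := by
  have h : ∀ j, blockMass η lam θ j = lam + if j ∈ θ then η - lam else 0 := by
    intro j; unfold blockMass; split_ifs <;> ring
  simp only [h, Finset.sum_add_distrib, Finset.sum_ite_mem, Finset.univ_inter, Finset.sum_const,
    (Finset.mem_powersetCard.1 hθ).2, Finset.card_univ, Fintype.card_fin, nsmul_eq_mul]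
  ring

theorem sum_abs_lightSpike_sub_one {N b K : ℕ} {η lam : ℝ} (hlam : 0 ≤ lam) (hb : 1 ≤ b)
    {θ : Finset (Fin N)} (hθ : θ ∈ powersetCard K (univ : Finset (Fin N))) (z : Fin N → Fin b) :
    ∑ x : Fin N × Fin b, |blockMass η lam θ x.1 * (1 / b) * lightSpike θ z x.1 x.2 -
        blockMass η lam θ x.1 * (1 / b)| = 2 * ((N - K) * lam * ((b - 1) / b)) := by
  have hb' : (1 : ℝ) ≤ b := by exact_mod_cast hb
  have hb0 : (b : ℝ) ≠ 0 := by linarith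
  rw [Fintype.sum_prod_type]
  have h : ∀ j, ∑ p, |blockMass η lam θ j * (1 / b) * lightSpike θ z j p -
        blockMass η lam θ j * (1 / b)| = blockMass 0 (2 * (lam * ((b - 1) / b))) θ j := by
    intro j
    unfold blockMass lightSpike
    by_cases hj : j ∈ θ
    · simp [hj]
    · have e : ∀ p, |lam * (1 / b) * ((b : ℝ) * if p = z j then 1 else 0) - lam * (1 / b)| =
          lam * (1 / b) + if p = z j then lam * ((b - 2) / b) else 0 := by
        intro p
        split_ifs
        · rw [abs_of_nonneg]
          · field_simp; ring
          · have : lam * (1 / b) ≤ lam * (1 / b) * b :=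
              le_mul_of_one_le_right (by positivity) hb'
            linarith
        · simp only [mul_zero, zero_sub, abs_neg, add_zero]
          exact abs_of_nonneg (by positivity)
      simp only [hj, if_false, e, Finset.sum_add_distrib, Finset.sum_ite_eq', Finset.mem_univ,
        if_true, Finset.sum_const, Finset.card_univ, Fintype.card_fin, nsmul_eq_mul]
      field_simp
      ring
  simp only [h, sum_blockMass _ _ hθ]
  ring

/-- An algorithm for two unknown laws cannot succeed on the masked block mixture. -/
theorem RandomizedAlgorithm.SolvesBothUnknown.false_of_masked {n k q r m T N b K : ℕ}
    {A : RandomizedAlgorithm k n} {ε η lam ρ : ℝ} (hsol : A.SolvesBothUnknown r ε)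
    (hA : A.UsesAtMost T) (hqr : q * r ≤ k) (hq : 60 ≤ q) (hm : 20 * T ≤ q * (m + 1))
    (hNb : N * b ≤ n) (hη : 0 < η) (hlam : 0 < lam) (hle : lam ≤ η) (hb : 1 ≤ b) (hKN : K ≤ N)
    (hmK : 2 * (m + T) ≤ K) (hK : 0 < K) (hmass : K * η + (N - K) * lam = 1)
    (hε : ε ≤ (N - K) * lam * ((b - 1) / b))
    (h1 : b * (lam / η) ^ 2 ≤ 1) (hρ : b * (lam / η) ^ 4 * (2 * N / K) ^ 2 ≤ ρ)
    (hfin : (1 + ρ * m * η) ^ m ≤ 5 / 4) : False := by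
  obtain ⟨l, hl⟩ := Nat.exists_eq_add_of_le hNb
  let E : Fin n ≃ (Fin N × Fin b) ⊕ Fin l := Fintype.equivOfCardEq (by simp [hl])
  let e : Fin N × Fin b → Fin n := fun s => E.symm (.inl s)
  have he : Function.Injective e := fun s s' h => Sum.inl_injective (E.symm.injective h)
  -- Since `Q` need not be uniform, elements outside the blocks simply receive mass zero.
  let lift : (Fin N × Fin b → ℝ) → Fin n → ℝ := fun p x => Sum.elim p (fun _ => 0) (E x)
  have hlift : ∀ p s, lift p (e s) = p s := fun p s => by simp [lift, e]
  have hlift0 : ∀ p x, x ∉ Set.range e → lift p x = 0 := by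
    intro p x hx
    rcases hEx : E x with s | y
    · exact absurd ⟨s, by simp [e, ← hEx]⟩ hx
    · simp [lift, hEx]
  have hsum : ∀ p, ∑ x, lift p x = ∑ s, p s := by
    intro p
    exact (Fintype.sum_of_injective e he p (lift p) (hlift0 p) fun s => (hlift p s).symm).symm
  have hlift_nonneg : ∀ p, (∀ s, 0 ≤ p s) → ∀ x, 0 ≤ lift p x := by
    intro p hp x
    rcases hEx : E x with s | y <;> simp [lift, hEx, hp]
  have hb' : (0 : ℝ) < b := by exact_mod_cast hb
  set F := powersetCard K (univ : Finset (Fin N)) with hF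
  have hFne : F.Nonempty := by
    rw [hF, Finset.powersetCard_nonempty]
    simpa using hKN
  let Qw : F → Fin N × Fin b → ℝ := fun θ x => blockMass η lam θ x.1 * (1 / b)
  let Pw : F → (Fin N → Fin b) → Fin N × Fin b → ℝ := fun θ z x =>
    blockMass η lam θ x.1 * (1 / b) * lightSpike θ.1 z x.1 x.2
  have hbm : ∀ θ : Finset (Fin N), ∀ j, 0 ≤ blockMass η lam θ j := by
    intro θ j; unfold blockMass; split_ifs <;> linarith
  have hmass' : ∀ θ ∈ F, ∑ j, blockMass η lam θ j = 1 := fun θ hθ => by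
    rw [sum_blockMass _ _ hθ, hmass]
  have hQ0 : ∀ θ x, 0 ≤ Qw θ x := fun θ x => mul_nonneg (hbm _ _) (by positivity)
  have hP0 : ∀ θ z x, 0 ≤ Pw θ z x := fun θ z x => mul_nonneg (hQ0 θ x) (by
    unfold lightSpike; split_ifs <;> positivity)
  have hQ1 : ∀ θ, ∑ x, Qw θ x = 1 := by
    intro θ
    rw [Fintype.sum_prod_type, ← hmass' θ.1 θ.2]
    refine Finset.sum_congr rfl fun j _ => ?_
    simp [Qw]
    field_simp
  have hP1 : ∀ θ z, ∑ x, Pw θ z x = 1 := by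
    intro θ z
    rw [Fintype.sum_prod_type, ← hmass' θ.1 θ.2]
    refine Finset.sum_congr rfl fun j _ => ?_
    simp only [Pw, mul_assoc, ← Finset.mul_sum]
    rw [Finset.mul_sum, sum_lightSpike hb, mul_one]
  let Q : F → PMF (Fin n) := fun θ => PMF.ofRealWeights (lift (Qw θ))
    (hlift_nonneg _ (hQ0 θ)) ((hsum _).trans (hQ1 θ))
  let P : F → (Fin N → Fin b) → PMF (Fin n) := fun θ z => PMF.ofRealWeights (lift (Pw θ z))
    (hlift_nonneg _ (hP0 θ z)) ((hsum _).trans (hP1 θ z))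
  have hQv : ∀ θ x, (Q θ x).toReal = lift (Qw θ) x := fun θ x =>
    PMF.ofRealWeights_apply_toReal _ _ _ x
  have hPv : ∀ θ z x, (P θ z x).toReal = lift (Pw θ z) x := fun θ z x =>
    PMF.ofRealWeights_apply_toReal _ _ _ x
  have hFne' : Nonempty F := hFne.to_subtype
  have hbne : Nonempty (Fin b) := ⟨⟨0, hb⟩⟩
  refine A.false_of_tape_indistinguishable hA hqr hq hm (Ω := F × (Fin N → Fin b))
    (fun ω => P ω.1 ω.2) (fun ω => Q ω.1) (fun I ω hI => hsol I _ _ hI ?_) fun G hG => ?_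
  · refine hε.trans (le_of_eq ?_)
    have e2 : ∀ x, |lift (Pw ω.1 ω.2) x - lift (Qw ω.1) x| =
        lift (fun s => |Pw ω.1 ω.2 s - Qw ω.1 s|) x := by
      intro x
      rcases hEx : E x with s | y <;> simp [lift, hEx]
    simp only [tvDist, hPv, hQv, e2, hsum]
    simp only [Pw, Qw]
    rw [sum_abs_lightSpike_sub_one hlam.le hb ω.1.2]
    ring
  · have htape : ∀ (p : Fin N × Fin b → ℝ) (M : ℕ) (H : (Fin M → Fin n) → ℝ),
        tapeSum (fun x => lift p x) M H = tapeSum p M fun xs => H fun s => e (xs s) :=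
      fun p M H => tapeSum_comp_injective e he _ p (hlift p) (hlift0 p) M H
    simp only [hPv, hQv, htape, Fintype.sum_prod_type]
    have key := masked_test_le hη hlam hle hb hKN hmK hK hmass' h1 hρ hfin
      (fun xs ys => G (fun s => e (xs s)) fun s => e (ys s)) fun xs ys => hG _ _
    rw [← Finset.sum_coe_sort F, ← Finset.sum_coe_sort F] at key
    refine key.trans (le_of_eq ?_)
    simp only [Qw, Fintype.card_prod, Fintype.card_coe, Fintype.card_fun, Fintype.card_fin]
    push_cast
    rfl

/-! ### The trivial bound and the choice of parameters -/

theorem tvDist_pure {n : ℕ} {x y : Fin n} (h : x ≠ y) :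
    tvDist (PMF.pure x) (PMF.pure y) = 1 := by
  have e : ∀ a, |((PMF.pure x) a).toReal - ((PMF.pure y) a).toReal| =
      (if a = x then 1 else 0) + if a = y then 1 else 0 := by
    intro a
    rw [PMF.pure_apply, PMF.pure_apply]
    by_cases h1 : a = x
    · subst h1
      simp [h]
    · by_cases h2 : a = y
      · subst h2
        simp [h1]
      · simp [h1, h2]
  simp only [tvDist, e, Finset.sum_add_distrib, Finset.sum_ite_eq', Finset.mem_univ, if_true]
  norm_num

/-- Every algorithm must query the smaller cluster at least once. -/
theorem RandomizedAlgorithm.SolvesBothUnknown.lt_samples {n k q r T : ℕ} (hn : 2 ≤ n)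
    {A : RandomizedAlgorithm k n} {ε : ℝ} (hsol : A.SolvesBothUnknown r ε) (hε : ε ≤ 1)
    (hA : A.UsesAtMost T) (hqr : q * r ≤ k) (hq : 60 ≤ q) : q < 20 * T := by
  by_contra! hT
  -- With an empty first tape the two sides coincide for any laws, even for point masses at distance
  -- `1`.
  refine A.false_of_tape_indistinguishable hA hqr hq (m := 0) (by simpa using hT) (Ω := Unit)
    (fun _ => PMF.pure ⟨0, by omega⟩) (fun _ => PMF.pure ⟨1, by omega⟩)
    (fun I ω hI => hsol I _ _ hI ?_) fun G hG => ?_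
  · rw [tvDist_pure (by simp [Fin.ext_iff])]
    exact hε
  · simp only [tapeSum_zero]
    simp

theorem RandomizedAlgorithm.SolvesBothUnknown.solvesOneKnown {n k r : ℕ} [NeZero n]
    {A : RandomizedAlgorithm k n} {ε : ℝ} (h : A.SolvesBothUnknown r ε) : A.SolvesOneKnown r ε :=
  fun I P hI hP => h I P _ hI hP

/-- For the total light mass `w = ε B / (B - 1)`: concentrating a light block of size `B` moves a
fraction `(B - 1) / B` of it, so the distance is exactly `ε`, and a mass of at least `1 / B` is left
for the heavy blocks. -/
theorem spike_mass_bounds {B δ ε : ℝ} (hB : 2 ≤ B) (hδB : 2 ≤ δ * B) (hε : 0 < ε)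
    (hεδ : ε ≤ 1 - δ) :
    0 < ε * (B / (B - 1)) ∧ ε * (B / (B - 1)) ≤ 2 * ε ∧ 1 / B ≤ 1 - ε * (B / (B - 1)) := by
  have hB1 : 0 < B - 1 := by linarith
  refine ⟨by positivity, ?_, ?_⟩
  · rw [mul_comm]
    refine mul_le_mul_of_nonneg_right ?_ hε.le
    rw [div_le_iff₀ hB1]
    linarith
  · have h2 : ε * (B / (B - 1)) ≤ (B - 2) / (B - 1) := by
      rw [mul_div_assoc', div_le_div_iff_of_pos_right hB1]
      nlinarith
    have h3 : (B - 2) / (B - 1) = 1 - 1 / (B - 1) := by field_simp; ring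
    have h4 : 1 / B ≤ 1 / (B - 1) := one_div_le_one_div_of_le hB1 (by linarith)
    linarith

theorem light_heavy_ratio_le {B ε w N K : ℝ} (hB : 0 < B) (hε : 0 < ε) (hw0 : 0 < w)
    (hw2 : w ≤ 2 * ε) (hw1 : 1 / B ≤ 1 - w) (hK : 0 < K) (hNK : 2 * K ≤ N) :
    w / (N - K) / ((1 - w) / K) ≤ 4 * ε * B * K / N := by
  have hw1' : 0 < 1 - w := lt_of_lt_of_le (by positivity) hw1
  have hNK0 : 0 < N - K := by linarith
  have e : w / (N - K) / ((1 - w) / K) = w * K / ((N - K) * (1 - w)) := by field_simp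
  rw [e, div_le_div_iff₀ (by positivity) (by linarith)]
  have h1 : 1 ≤ B * (1 - w) := by rwa [div_le_iff₀' hB] at hw1
  have h2 : N ≤ 2 * (N - K) := by linarith
  have h3 : 0 < N := by linarith
  calc w * K * N ≤ (2 * ε) * K * (2 * (N - K)) := by gcongr
    _ = (4 * ε * K * (N - K)) * 1 := by ring
    _ ≤ (4 * ε * K * (N - K)) * (B * (1 - w)) := by gcongr
    _ = _ := by ring

/-- Source of the exponent `2/3`: with `K` of order `T`, `m` of order `T / κ` and `N` of order `n`,
the quantity `ρ m² η` is of order `ε⁴ T³ / (κ n)²`. -/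
theorem masked_exponent_le {B ε N K m T κ n Λ η : ℝ} (hB : 2 ≤ B) (hε : 0 < ε) (hn : 0 < n)
    (hκ : 0 < κ) (hK : 0 < K) (hN : 0 < N) (hm0 : 0 ≤ m) (hT0 : 0 ≤ T) (hη0 : 0 ≤ η)
    (hΛ0 : 0 ≤ Λ)
    (hΛ : Λ ≤ 4 * ε * B * K / N) (hη : η ≤ 1 / K) (hKT : K ≤ 4 * T)
    (hm : m ≤ 40 * T / κ) (hNn : n / (2 * B) ≤ N)
    (hT3 : T ^ 3 ≤ (1 / (1000 * B ^ 3)) ^ 3 * (n * κ / ε ^ 2) ^ 2) :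
    m * (B * Λ ^ 4 * (2 * N / K) ^ 2 * m * η) ≤ 1 / 5 := by
  have hB0 : 0 < B := by linarith
  have hB_inv : 1 / B ≤ 1 := by rw [div_le_one hB0]; linarith
  calc m * (B * Λ ^ 4 * (2 * N / K) ^ 2 * m * η)
      = B * Λ ^ 4 * (2 * N / K) ^ 2 * m ^ 2 * η := by ring
    _ ≤ B * (4 * ε * B * K / N) ^ 4 * (2 * N / K) ^ 2 * m ^ 2 * (1 / K) := by gcongr
    _ = 1024 * B ^ 5 * ε ^ 4 * K * m ^ 2 / N ^ 2 := by field_simp; ring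
    _ ≤ 1024 * B ^ 5 * ε ^ 4 * (4 * T) * (40 * T / κ) ^ 2 / (n / (2 * B)) ^ 2 := by gcongr
    _ = 26214400 * B ^ 7 * ε ^ 4 / (κ ^ 2 * n ^ 2) * T ^ 3 := by field_simp; ring
    _ ≤ 26214400 * B ^ 7 * ε ^ 4 / (κ ^ 2 * n ^ 2) *
        ((1 / (1000 * B ^ 3)) ^ 3 * (n * κ / ε ^ 2) ^ 2) := by gcongr
    _ = 26214400 / 1000000000 * (1 / B) ^ 2 := by field_simp; norm_num
    _ ≤ 26214400 / 1000000000 * 1 ^ 2 := by gcongr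
    _ ≤ 1 / 5 := by norm_num

/-- The number of blocks is large compared to the number of heavy blocks. -/
theorem block_count_facts {B n T K : ℕ} (hB : 2 ≤ B) (hT : 1 ≤ T)
    (hTn : 1000 * B ^ 3 * T < n) (hKT : K ≤ 4 * T) :
    n ≤ 2 * (B * (n / B)) ∧ 125 * B ^ 2 * K ≤ n / B := by
  have hB0 : 0 < B := by omega
  have hBn : B ≤ n := by
    calc B ≤ B ^ 3 := Nat.le_self_pow (by norm_num) B
      _ ≤ B ^ 3 * (1000 * T) := Nat.le_mul_of_pos_right _ (by omega)
      _ = 1000 * B ^ 3 * T := by ring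
      _ ≤ n := hTn.le
  have h1 := Nat.div_add_mod n B
  have h2 := Nat.mod_lt n hB0
  have h3 : 1 ≤ n / B := (Nat.one_le_div_iff hB0).2 hBn
  have h4 : B * 1 ≤ B * (n / B) := Nat.mul_le_mul_left B h3
  refine ⟨by omega, ?_⟩
  rw [Nat.le_div_iff_mul_le hB0]
  calc 125 * B ^ 2 * K * B ≤ 125 * B ^ 2 * (4 * T) * B := by gcongr
    _ ≤ 1000 * B ^ 3 * T := by
      have : 125 * B ^ 2 * (4 * T) * B = 500 * (B ^ 3 * T) := by ring
      rw [this, mul_assoc]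
      omega
    _ ≤ n := hTn.le

/-- The masking regime: `κ / ε² ≤ √n` where `κ = k / r`. -/
theorem masked_lower_bound {B : ℕ} (hB2 : 2 ≤ B) {δ : ℝ} (hδ : 0 < δ) (hBδ : 2 / δ ≤ B)
    {n k r T : ℕ} (hn : 2 ≤ n) (hr : 1 ≤ r) (hrk : (r : ℝ) ≤ (k : ℝ) / 60) {ε : ℝ} (hε : 0 < ε)
    (hεδ : ε ≤ 1 - δ) {A : RandomizedAlgorithm k n} (hA : A.UsesAtMost T)
    (hsol : A.SolvesBothUnknown r ε) {M : ℝ} (hMn : M ≤ n)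
    (hM3 : M ^ 3 = (n * (k / r) / ε ^ 2) ^ 2) : 1 / (1000 * (B : ℝ) ^ 3) * M ≤ T := by
  by_contra! hT
  obtain ⟨hq, hqr, -⟩ := div_nat_facts hr hrk
  obtain ⟨hm, hmT⟩ := tape_length_facts (T := T) hr hrk
  have hqT : k / r < 20 * T := hsol.lt_samples hn (by linarith) hA hqr hq
  generalize 20 * T / (k / r) = m at hm hmT
  generalize hκ : (k : ℝ) / r = κ at hM3 hmT
  have hr' : (0 : ℝ) < r := by exact_mod_cast hr
  have hκ60 : 60 ≤ κ := by rw [← hκ, le_div_iff₀ hr']; linarith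
  have hT1 : 1 ≤ T := by omega
  have hm0 : (0 : ℝ) ≤ m := Nat.cast_nonneg m
  have hmT' : m ≤ T := by
    have : (m : ℝ) ≤ T := by nlinarith only [hmT, hκ60, hm0]
    exact_mod_cast this
  have hBr : (2 : ℝ) ≤ B := by exact_mod_cast hB2
  have hB0 : (0 : ℝ) < B := by linarith
  have hn' : (0 : ℝ) < n := by exact_mod_cast (by omega : 0 < n)
  have hTn : (1000 * B ^ 3) * (T : ℝ) < n := by
    rw [div_mul_eq_mul_div, one_mul, lt_div_iff₀ (by positivity)] at hT
    linarith
  -- The smallest number of heavy blocks for which the samples leave half of them unseen; a larger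
  -- `K` would weaken the masking.
  obtain ⟨K, hK⟩ : ∃ K, K = 2 * (m + T) := ⟨_, rfl⟩
  have hK0 : 0 < K := by omega
  have hKr : (0 : ℝ) < K := by exact_mod_cast hK0
  have hKT : K ≤ 4 * T := by omega
  obtain ⟨hnN, hNK125⟩ := block_count_facts hB2 hT1 (by exact_mod_cast hTn) hKT
  have hNB : n / B * B ≤ n := Nat.div_mul_le_self n B
  generalize n / B = N at hnN hNK125 hNB
  have hnNr : (n : ℝ) ≤ 2 * (B * N) := by exact_mod_cast hnN
  have hNr : 125 * (B : ℝ) ^ 2 * K ≤ N := by exact_mod_cast hNK125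
  have hNK : 2 * (K : ℝ) ≤ N := by
    refine le_trans (mul_le_mul_of_nonneg_right ?_ hKr.le) hNr
    nlinarith only [hBr]
  have hN0 : (0 : ℝ) < N := by linarith
  have hNK0 : (0 : ℝ) < N - K := by linarith
  have hB1 : (0 : ℝ) < B - 1 := by linarith
  obtain ⟨hw0, hw2, hw1⟩ := spike_mass_bounds hBr (by rwa [div_le_iff₀' hδ] at hBδ) hε hεδ
  obtain ⟨w, hw⟩ : ∃ w, w = ε * ((B : ℝ) / (B - 1)) := ⟨_, rfl⟩
  rw [← hw] at hw0 hw2 hw1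
  have hw1' : 0 < 1 - w := lt_of_lt_of_le (by positivity) hw1
  have hΛ := light_heavy_ratio_le hB0 hε hw0 hw2 hw1 hKr hNK
  obtain ⟨η, hη⟩ : ∃ η, η = (1 - w) / (K : ℝ) := ⟨_, rfl⟩
  obtain ⟨lam, hlam⟩ : ∃ lam, lam = w / ((N : ℝ) - K) := ⟨_, rfl⟩
  rw [← hη, ← hlam] at hΛ
  have hη0 : 0 < η := by rw [hη]; positivity
  have hlam0 : 0 < lam := by rw [hlam]; positivity
  have hΛ0 : 0 ≤ lam / η := by positivity
  have hΛB : lam / η ≤ 1 / B := by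
    refine hΛ.trans ?_
    rw [div_le_div_iff₀ hN0 hB0]
    calc 4 * ε * B * K * B = ε * (4 * B ^ 2 * K) := by ring
      _ ≤ 1 * (125 * B ^ 2 * K) := by
          gcongr
          · linarith
          · norm_num
      _ ≤ 1 * N := by linarith
  have hB_inv : 1 / (B : ℝ) ≤ 1 := by rw [div_le_one hB0]; linarith
  refine hsol.false_of_masked (K := K) (N := N) (b := B) (η := η) (lam := lam)
    (ρ := B * (lam / η) ^ 4 * (2 * N / K) ^ 2) hA hqr hq hm hNB hη0 hlam0 ?_ (by omega) ?_
    hK.ge hK0 ?_ ?_ ?_ le_rfl ?_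
  · rw [← div_le_one hη0]; linarith
  · have : (K : ℝ) ≤ N := by linarith
    exact_mod_cast this
  · rw [hη, hlam]; field_simp; ring
  · have : ((N : ℝ) - K) * lam * ((B - 1) / B) = ε := by rw [hlam, hw]; field_simp
    exact this.ge
  · calc (B : ℝ) * (lam / η) ^ 2 ≤ (B : ℝ) * (1 / (B : ℝ)) ^ 2 := by gcongr
      _ = 1 / (B : ℝ) := by field_simp
      _ ≤ 1 := hB_inv
  · have hx := masked_exponent_le (m := m) (T := T) (κ := κ) (η := η) hBr hε hn' (by linarith) hKr
      hN0 hm0 (Nat.cast_nonneg T) hη0.le hΛ0 hΛ (by rw [hη]; gcongr; linarith) (by exact_mod_cast hKT)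
      (by rwa [le_div_iff₀ (by linarith)]) (by rw [div_le_iff₀ (by linarith)]; linarith)
      (by rw [← hM3, ← mul_pow]; gcongr)
    have hx0 : 0 ≤ (B : ℝ) * (lam / η) ^ 4 * (2 * N / K) ^ 2 * m * η := by positivity
    generalize (B : ℝ) * (lam / η) ^ 4 * (2 * N / K) ^ 2 * m * η = x at hx hx0
    calc (1 + x) ^ m ≤ Real.exp x ^ m := by
          gcongr
          linarith [Real.add_one_le_exp x]
      _ = Real.exp (m * x) := by rw [← Real.exp_nat_mul]
      _ ≤ 5 / 4 := exp_le_five_fourths hx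

/-! ### Combining the regimes -/

theorem theorem4p1 (δ : ℝ) (hδ : 0 < δ) :
    ∃ c : ℝ, 0 < c ∧
      ∀ (n k r : ℕ) [NeZero n] (ε : ℝ),
        2 ≤ n → 60 ≤ k → 1 ≤ r → (r : ℝ) ≤ (k : ℝ) / 60 → 0 < ε → ε ≤ 1 - δ →
        ∀ (A : RandomizedAlgorithm k n) (T : ℕ), A.UsesAtMost T →
          (ε ≤ 1 - 1 / (n : ℝ) → A.SolvesOneKnown r ε →
            c * ((k : ℝ) * Real.sqrt (n : ℝ) / ((r : ℝ) * ε ^ 2)) ≤ (T : ℝ)) ∧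
          (A.SolvesBothUnknown r ε →
            c * max ((k : ℝ) * Real.sqrt (n : ℝ) / ((r : ℝ) * ε ^ 2))
                (((n : ℝ) * (k : ℝ) / ((r : ℝ) * ε ^ 2)) ^ ((2 : ℝ) / 3)) ≤ (T : ℝ)) := by
  obtain ⟨c₁, hc₁, hone⟩ := exists_one_known_constant δ hδ
  obtain ⟨B, hB⟩ := exists_nat_ge (max (2 / δ) 2)
  have hBδ : 2 / δ ≤ B := (le_max_left _ _).trans hB
  have hB2 : 2 ≤ B := by exact_mod_cast (le_max_right _ _).trans hB
  have hBr : (2 : ℝ) ≤ B := by exact_mod_cast hB2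
  have hB3 : (B : ℝ) ≤ (B : ℝ) ^ 3 := le_self_pow₀ (by linarith) (by norm_num)
  set c₂ : ℝ := 1 / (1000 * (B : ℝ) ^ 3) with hc₂
  have hc₂0 : 0 < c₂ := by positivity
  refine ⟨min c₁ c₂, lt_min hc₁ hc₂0, ?_⟩
  intro n k r _ ε hn _ hr hrk hε hεδ A T hA
  have hX0 : 0 ≤ (k : ℝ) * Real.sqrt n / (r * ε ^ 2) := by positivity
  refine ⟨fun hεn hsol => ?_, fun hsol => ?_⟩
  · exact (mul_le_mul_of_nonneg_right (min_le_left _ _) hX0).trans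
      (hone n k r ε hn hr hrk hε hεδ A T hA hεn hsol)
  set X : ℝ := (k : ℝ) * Real.sqrt n / (r * ε ^ 2) with hX
  set M : ℝ := ((n : ℝ) * (k : ℝ) / ((r : ℝ) * ε ^ 2)) ^ ((2 : ℝ) / 3) with hM
  have hM0 : 0 ≤ M := by positivity
  have hr' : (0 : ℝ) < r := by exact_mod_cast hr
  have hn' : (0 : ℝ) < n := by exact_mod_cast (by omega : 0 < n)
  set κ : ℝ := (k : ℝ) / r with hκ
  have hκ60 : 60 ≤ κ := by rw [hκ, le_div_iff₀ hr']; linarith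
  have hεsq : 0 < ε ^ 2 := by positivity
  have hss : Real.sqrt n * Real.sqrt n = n := Real.mul_self_sqrt hn'.le
  have hs0 : 0 < Real.sqrt n := Real.sqrt_pos.2 hn'
  have hXκ : X = κ / ε ^ 2 * Real.sqrt n := by rw [hX, hκ]; field_simp
  have hbase : (n : ℝ) * k / (r * ε ^ 2) = n * κ / ε ^ 2 := by rw [hκ]; field_simp
  have hM3 : M ^ 3 = (n * κ / ε ^ 2) ^ 2 := by
    rw [hM, hbase, ← Real.rpow_natCast, ← Real.rpow_mul (by positivity)]
    norm_num
  by_cases hεn : ε ≤ 1 - 1 / (n : ℝ)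
  · have hTX : c₁ * X ≤ T := hone n k r ε hn hr hrk hε hεδ A T hA hεn hsol.solvesOneKnown
    rcases le_or_gt M X with hMX | hXM
    · rw [max_eq_left hMX]
      exact (mul_le_mul_of_nonneg_right (min_le_left _ _) hX0).trans hTX
    · rw [max_eq_right hXM.le]
      refine (mul_le_mul_of_nonneg_right (min_le_right _ _) hM0).trans ?_
      -- With `Y = κ / ε²` one has `X³ = Y³ n √n` and `M³ = Y² n²`, so the second term dominates
      -- only when `Y ≤ √n`; then `M ≤ n`, which leaves room for many more blocks than samples.
      have hY : κ / ε ^ 2 ≤ Real.sqrt n := by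
        have h1 : X ^ 3 ≤ M ^ 3 := pow_le_pow_left₀ hX0 hXM.le 3
        set Y := κ / ε ^ 2 with hYdef
        have hY0 : 0 < Y := by positivity
        have e1 : X ^ 3 = (Y ^ 2 * (n * Real.sqrt n)) * Y := by
          rw [hXκ]; linear_combination Y ^ 3 * Real.sqrt n * hss
        have e2 : M ^ 3 = (Y ^ 2 * (n * Real.sqrt n)) * Real.sqrt n := by
          rw [hM3, mul_div_assoc, ← hYdef]; linear_combination (-(Y ^ 2) * n) * hss
        rw [e1, e2] at h1
        exact le_of_mul_le_mul_left h1 (by positivity)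
      have hMn : M ≤ n := by
        refine le_of_pow_le_pow_left₀ (n := 3) (by norm_num) hn'.le ?_
        rw [hM3, mul_div_assoc]
        calc (n * (κ / ε ^ 2)) ^ 2 ≤ (n * Real.sqrt n) ^ 2 := by gcongr
          _ = (n : ℝ) ^ 3 := by linear_combination (n : ℝ) ^ 2 * hss
      exact masked_lower_bound hB2 hδ hBδ hn hr hrk hε hεδ hA hsol hMn hM3
  -- Here no law is far enough from uniform for the first part to be used. But `1 - 1/n < ε ≤ 1 - δ`
  -- bounds `n` by `B` and gives `ε ≥ 1/2`, so both terms are at most `4 B κ` and the trivial bound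
  -- of order `κ` suffices.
  · push Not at hεn
    obtain ⟨hq, hqr, hκq⟩ := div_nat_facts hr hrk
    have hqT : ((k / r : ℕ) : ℝ) ≤ 20 * T := by
      exact_mod_cast (hsol.lt_samples hn (by linarith) hA hqr hq).le
    have hκT : κ ≤ 40 * T := by linarith
    have hn2 : (2 : ℝ) ≤ n := by exact_mod_cast hn
    have hinv : 1 / (n : ℝ) ≤ 1 / 2 := one_div_le_one_div_of_le (by norm_num) hn2
    have hε2 : 1 / 2 ≤ ε := by linarith
    have hnB : (n : ℝ) ≤ B := by
      have h1 : δ < 1 / n := by linarith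
      have h2 : δ * n < 1 := by rwa [lt_div_iff₀ hn'] at h1
      have h3 : 2 ≤ B * δ := by rwa [div_le_iff₀ hδ] at hBδ
      nlinarith only [h2, h3, hn2, hδ, hBr]
    have hε4 : 1 / ε ^ 2 ≤ 4 := by
      rw [div_le_iff₀ hεsq]; nlinarith only [hε2]
    have hsn : Real.sqrt n ≤ n := by
      rw [Real.sqrt_le_left hn'.le]; nlinarith only [hn2]
    have hbig : n * κ / ε ^ 2 ≤ 4 * B * κ := by
      calc n * κ / ε ^ 2 = n * κ * (1 / ε ^ 2) := by ring
        _ ≤ B * κ * 4 := by gcongr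
        _ = _ := by ring
    have hXle : X ≤ 4 * B * κ := by
      refine le_trans ?_ hbig
      calc X = Real.sqrt n * κ / ε ^ 2 := by rw [hXκ]; ring
        _ ≤ n * κ / ε ^ 2 := by gcongr
    have hMle : M ≤ 4 * B * κ := by
      refine le_trans ?_ hbig
      rw [hM, hbase]
      have h1 : 1 ≤ n * κ / ε ^ 2 := by
        rw [le_div_iff₀ hεsq, one_mul]
        have h2 : ε ^ 2 ≤ 1 := pow_le_one₀ hε.le (by linarith)
        nlinarith only [h2, hn2, hκ60]
      calc (n * κ / ε ^ 2) ^ ((2 : ℝ) / 3) ≤ (n * κ / ε ^ 2) ^ (1 : ℝ) :=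
            Real.rpow_le_rpow_of_exponent_le h1 (by norm_num)
        _ = _ := Real.rpow_one _
    calc min c₁ c₂ * max X M ≤ c₂ * (4 * B * κ) := by
          gcongr
          · exact min_le_right _ _
          · exact max_le hXle hMle
      _ ≤ c₂ * (4 * B * (40 * T)) := by gcongr
      _ = 160 * B * T / (1000 * B ^ 3) := by rw [hc₂]; ring
      _ ≤ T := by
          rw [div_le_iff₀ (by positivity)]
          nlinarith only [(Nat.cast_nonneg T : (0 : ℝ) ≤ T), hB3, hBr]
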